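/- **Setting.** Let $\Omega$ be a quantum star graph with $n$ edges, the $i$-th being $[0,\ell_i]$ with $\ell_i>0$, where the points $0$ of all edges are identified with the common origin. Let $V_i\in L^1(0,\ell_i)$ be real-valued and let $\alpha_1,\alpha_2,\beta_1,\beta_2\in\mathbb C^{n\times n}$ satisfy $\operatorname{rank}[\alpha_1\ \alpha_2]=\operatorname{rank}[\beta_1\ \beta_2]=n$, $\alpha_1\alpha_2^*=\alpha_2\alpha_1^*$, $\beta_1\beta_2^*=\beta_2\beta_1^*$, with $\beta_1,\beta_2$ diagonal. The boundary conditions $\Gamma$ for $\vec u=(u_1,\dots,u_n)$ are $$\alpha_1\vec u(\vec 0)+\alpha_2\vec u'(\vec 0)=\vec 0,\qquad \beta_1\vec u(\vec\ell)+\beta_2\vec u'(\vec\ell)=\vec 0 .$$ Let $H^\Omega=\operatorname{diag}(-\partial_{x_i}^2+V_i)$, and let $H^\Omega_\Gamma$ be the operator in $L^2(\Omega)=\bigoplus_i L^2(0,\ell_i)$ acting as $\vec u\mapsto H^\Omega\vec u$ on the domain of all $\vec u\in L^2(\Omega)$ such that $u_i,u_i'$ are absolutely continuous on $[0,\ell_i]$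 for every $i$, $H^\Omega\vec u\in L^2(\Omega)$, and $\vec u$ satisfies $\Gamma$. (If every $V_i$ is in $L^2$, this domain is $\{\vec u\in H^2(\Omega):\vec u\text{ satisfies }\Gamma\}$.) Operators on subgraphs are defined in the same way. **Splitting.** Let $0<s_1<\ell_j$. Cutting edge $j$ at $s_1$ gives $\Omega_1=[s_1,\ell_j]$ and the star graph $\Omega_2\ni 0$, in which edge $j$ is replaced by $[0,s_1]$. The conditions $\Gamma_1$ on $\Omega_1$ and $\Gamma_2$ on $\Omega_2$ agree with $\Gamma$ at the vertices of $\Omega$ and are the Dirichlet condition at $s_1$. Next cut $\Omega_2$ at an interior point $x_k=s_2$ of its edge $k$: thus $0<s_2<\ell_k$, and $s_2<s_1$ if $k=j$. The part containing $0$ is $\tilde\Omega_2$, the other is $\tilde\Omega_1$, so $\tilde\Omega_1=[s_2,s_1]$ if $k=j$ and $\tilde\Omega_1=[s_2,\ell_k]$ if $k\ne j$. The conditions $\tilde\Gamma_1,\tilde\Gamma_2$ agree with $\Gamma_2$ at the vertices of $\Omega_2$ and are the Dirichlet condition at $s_2$. **Two-sided map.** For $\lambda\in\mathbb C$ and $f\in\mathbb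 C^2$ consider solutions of $(H-\lambda)u=0$ on the indicated pieces which satisfy the stated conditions at the cut points and the homogeneous conditions inherited from $\Gamma$ at all other vertices. The $2\times2$ matrices $\mathcal M_1(\lambda),\mathcal M_2(\lambda)$ are defined for those $\lambda$ for which these solutions exist and are unique for every $f$ (all $\lambda$ outside the spectra of the piece operators involved). * If $k=j$: $\mathcal M_1(\lambda)f=(u'(s_1),\,-u'(s_2))^t$, where $u$ is the solution on $\tilde\Omega_1$ with $u(s_1)=f_1$, $u(s_2)=f_2$; and $\mathcal M_2(\lambda)f=(-u'(s_1),\,v_j'(s_2))^t$, where $u$ is the solution on $\Omega_1$ with $u(s_1)=f_1$ and $\vec v$ is the solution on $\tilde\Omega_2$ with $v_j(s_2)=f_2$. * If $k\neq j$: $\mathcal M_1(\lambda)f=(-u'(s_1),\,-v'(s_2))^t$, where $u$ is the solution on $\Omega_1$ with $u(s_1)=f_1$ and $v$ is the solution on $\tilde\Omega_1$ with $v(s_2)=f_2$; and $\mathcal M_2(\lambda)f=(u_j'(s_1),\,u_k'(s_2))^t$, where $\vec u$ is the solution on $\tilde\Omega_2$ with $u_j(s_1)=f_1$, $u_k(s_2)=f_2$.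 **Theorem.** The function $\det(\mathcal M_1+\mathcal M_2)$ is meromorphic on $\mathbb C$ and not identically zero. For $\lambda\in\mathbb R$ let $\mathcal N_X(\lambda)$ be the number of eigenvalues $\le\lambda$ of an operator $X$, counted with multiplicity, and let $N(\lambda)$ be the number of zeros minus the number of poles of $\det(\mathcal M_1+\mathcal M_2)$ in $(-\infty,\lambda]$, counted with multiplicity. Then all these numbers are finite and $$\mathcal N_{H^\Omega_\Gamma}(\lambda)=\mathcal N_{H^{\Omega_1}_{\Gamma_1}}(\lambda)+\mathcal N_{H^{\tilde\Omega_1}_{\tilde\Gamma_1}}(\lambda)+\mathcal N_{H^{\tilde\Omega_2}_{\tilde\Gamma_2}}(\lambda)+N(\lambda).$$ -/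

import Mathlib

open MeasureTheory Set
open scoped Matrix ENNReal

namespace QuantumStar

noncomputable section

/-- `F` is absolutely continuous on `[a, b]` with (integrable, a.e. defined) derivative `f`. -/
def IsPrimitiveOn (a b : ℝ) (F f : ℝ → ℂ) : Prop :=
  IntervalIntegrable f volume a b ∧ ∀ x ∈ Icc a b, F x = F a + ∫ t in a..x, f t

theorem isPrimitiveOn_add {a b : ℝ} {F f G g : ℝ → ℂ} (hF : IsPrimitiveOn a b F f)
    (hG : IsPrimitiveOn a b G g) : IsPrimitiveOn a b (F + G) (f + g) := by
  refine ⟨hF.1.add hG.1, fun x hx => ?_⟩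
  have hs : uIcc a x ⊆ uIcc a b := by
    rw [uIcc_of_le hx.1, uIcc_of_le (hx.1.trans hx.2)]
    exact Icc_subset_Icc_right hx.2
  have h := intervalIntegral.integral_add (hF.1.mono_set hs) (hG.1.mono_set hs)
  simp only [Pi.add_apply]
  rw [h, hF.2 x hx, hG.2 x hx]
  ring

theorem isPrimitiveOn_smul {a b : ℝ} {F f : ℝ → ℂ} (c : ℂ) (hF : IsPrimitiveOn a b F f) :
    IsPrimitiveOn a b (c • F) (c • f) := by
  refine ⟨hF.1.smul c, fun x hx => ?_⟩
  have h := intervalIntegral.integral_smul (μ := volume) (a := a) (b := x) c f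
  simp only [Pi.smul_apply]
  rw [h, hF.2 x hx, smul_add]

theorem isPrimitiveOn_zero {a b : ℝ} {F f : ℝ → ℂ} (hF : IsPrimitiveOn a b F f)
    (h0 : F =ᵐ[volume.restrict (Ioc a b)] 0) :
    (a < b → ∀ x ∈ Icc a b, F x = 0) ∧ f =ᵐ[volume.restrict (Ioc a b)] 0 := by
  rcases lt_or_ge a b with hab | hab
  · have hcont : ContinuousOn F (Icc a b) := by
      have h1 : ContinuousOn (fun x => F a + ∫ t in a..x, f t) (Icc a b) := by
        have := intervalIntegral.continuousOn_primitive_interval'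
          (μ := volume) hF.1 (left_mem_uIcc)
        rw [uIcc_of_le hab.le] at this
        exact continuousOn_const.add this
      exact h1.congr fun x hx => hF.2 x hx
    have hz : EqOn F 0 (Icc a b) :=
      Measure.eqOn_Icc_of_ae_eq volume hab.ne
        (by rwa [Measure.restrict_congr_set Ioc_ae_eq_Icc] at h0) hcont continuousOn_const
    refine ⟨fun _ x hx => hz hx, ?_⟩
    have hd := hF.1.ae_hasDerivAt_integral
    rw [Filter.EventuallyEq, Measure.restrict_congr_set (Ioo_ae_eq_Ioc (μ := volume)).symm,
      ae_restrict_iff' measurableSet_Ioo]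
    filter_upwards [hd] with x hx hxm
    have hx' := hx (by rw [uIcc_of_le hab.le]; exact Ioo_subset_Icc_self hxm) a left_mem_uIcc
    have he : (fun y => ∫ t in a..y, f t) =ᶠ[nhds x] fun _ => (0 : ℂ) := by
      filter_upwards [Icc_mem_nhds hxm.1 hxm.2] with y hy
      have h2 := hF.2 y hy
      rw [hz hy, hz (left_mem_Icc.2 hab.le)] at h2
      simpa using h2.symm
    exact (hx'.congr_of_eventuallyEq he.symm).unique (hasDerivAt_const x (0 : ℂ))
  · refine ⟨fun h => absurd h (not_lt.2 hab), ?_⟩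
    rw [Ioc_eq_empty (not_lt.2 hab), Measure.restrict_empty, Filter.EventuallyEq, ae_zero]
    exact Filter.eventually_bot

/-- A Schrödinger problem on a quantum star graph with edges indexed by `ι`. Edge `i` is the
interval `[a i, b i]`; the left endpoints `a i` are the ones joined at the common vertex, the right
endpoints `b i` are the outer vertices. `V i` is the potential on edge `i`, and the matrices encode
the boundary conditions `α₁ u(a) + α₂ u'(a) = 0` and `β₁ u(b) + β₂ u'(b) = 0`. -/
structure Problem (ι : Type) where
  a : ι → ℝ
  b : ι → ℝ
  V : ι → ℝ → ℝ
  α₁ : Matrix ι ι ℂ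
  α₂ : Matrix ι ι ℂ
  β₁ : Matrix ι ι ℂ
  β₂ : Matrix ι ι ℂ

namespace Problem

variable {ι : Type} [Fintype ι] [DecidableEq ι]

/-- The trace `γ_Γ u`: the outer (`β`) block first, then the block at the common vertex (`α`). Here
`u'` is the derivative of `u`. -/
def trace (P : Problem ι) (u u' : ι → ℝ → ℂ) : ι ⊕ ι → ℂ :=
  Sum.elim
    (P.β₁ *ᵥ (fun i => u i (P.b i)) + P.β₂ *ᵥ (fun i => u' i (P.b i)))
    (P.α₁ *ᵥ (fun i => u i (P.a i)) + P.α₂ *ᵥ (fun i => u' i (P.a i)))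

/-- On every edge, `u` is absolutely continuous with derivative `u'`, and `u'` is absolutely
continuous with derivative `u''`. -/
def IsTwiceDiff (P : Problem ι) (u u' u'' : ι → ℝ → ℂ) : Prop :=
  ∀ i, IsPrimitiveOn (P.a i) (P.b i) (u i) (u' i) ∧ IsPrimitiveOn (P.a i) (P.b i) (u' i) (u'' i)

/-- The Hilbert space `L²(Ω) = ⨁ᵢ L²(aᵢ, bᵢ)`. -/
abbrev L2 (P : Problem ι) : Type :=
  PiLp 2 (fun i => Lp ℂ 2 (volume.restrict (Ioc (P.a i) (P.b i))))

/-- The pairs `(f, g)` in `L²(Ω) × L²(Ω)` such that `f` is represented by a function `u` with `u`,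
`u'` absolutely continuous and `γ_Γ u = 0`, and `g = -u'' + V u`. -/
def operatorGraph (P : Problem ι) : Submodule ℂ (P.L2 × P.L2) where
  carrier := {fg | ∃ u u' u'' : ι → ℝ → ℂ, P.IsTwiceDiff u u' u'' ∧ P.trace u u' = 0 ∧
    ∀ i, fg.1 i =ᵐ[volume.restrict (Ioc (P.a i) (P.b i))] u i ∧
      fg.2 i =ᵐ[volume.restrict (Ioc (P.a i) (P.b i))] fun x => -u'' i x + (P.V i x : ℂ) * u i x}
  zero_mem' := by
    refine ⟨fun _ _ => 0, fun _ _ => 0, fun _ _ => 0, fun i => ?_, ?_, fun i => ⟨?_, ?_⟩⟩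
    · simp [IsPrimitiveOn]
    · ext x
      rcases x with x | x <;>
        simp [trace, Matrix.mulVec, dotProduct]
    · exact Lp.coeFn_zero _ _ _
    · filter_upwards [Lp.coeFn_zero ℂ 2 (volume.restrict (Ioc (P.a i) (P.b i)))] with x hx
      simpa using hx
  add_mem' := by
    rintro ⟨f, g⟩ ⟨f₂, g₂⟩ ⟨u, u', u'', hu, ht, hr⟩ ⟨v, v', v'', hv, ht', hr'⟩
    refine ⟨u + v, u' + v', u'' + v'', fun i => ⟨?_, ?_⟩, ?_, fun i => ⟨?_, ?_⟩⟩
    · exact isPrimitiveOn_add (hu i).1 (hv i).1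
    · exact isPrimitiveOn_add (hu i).2 (hv i).2
    · have : P.trace (u + v) (u' + v') = P.trace u u' + P.trace v v' := by
        ext x
        rcases x with x | x <;>
          simp [trace, Matrix.mulVec, dotProduct, mul_add, Finset.sum_add_distrib] <;> ring
      rw [this, ht, ht', add_zero]
    · filter_upwards [(hr i).1, (hr' i).1, Lp.coeFn_add (f i) (f₂ i)] with x h₁ h₂ h₃
      simp only [Prod.mk_add_mk, PiLp.add_apply, Pi.add_apply] at *
      rw [h₃, h₁, h₂]
    · filter_upwards [(hr i).2, (hr' i).2, Lp.coeFn_add (g i) (g₂ i)] with x h₁ h₂ h₃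
      simp only [Prod.mk_add_mk, PiLp.add_apply, Pi.add_apply] at *
      rw [h₃, h₁, h₂]
      ring
  smul_mem' := by
    rintro c ⟨f, g⟩ ⟨u, u', u'', hu, ht, hr⟩
    refine ⟨c • u, c • u', c • u'', fun i => ⟨?_, ?_⟩, ?_, fun i => ⟨?_, ?_⟩⟩
    · exact isPrimitiveOn_smul c (hu i).1
    · exact isPrimitiveOn_smul c (hu i).2
    · have : P.trace (c • u) (c • u') = c • P.trace u u' := by
        ext x
        rcases x with x | x <;>
          simp [trace, Matrix.mulVec, dotProduct, mul_add, Finset.mul_sum, mul_left_comm]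
      rw [this, ht, smul_zero]
    · filter_upwards [(hr i).1, Lp.coeFn_smul c (f i)] with x h₁ h₃
      simp only [Prod.smul_mk, PiLp.smul_apply, Pi.smul_apply] at *
      rw [h₃, h₁]
    · filter_upwards [(hr i).2, Lp.coeFn_smul c (g i)] with x h₁ h₃
      simp only [Prod.smul_mk, PiLp.smul_apply, Pi.smul_apply, smul_eq_mul] at *
      rw [h₃, h₁]
      ring

/-- `operatorGraph` is the graph of a function. -/
theorem operatorGraph_functional (P : Problem ι) (x : P.L2 × P.L2) (hx : x ∈ P.operatorGraph)
    (h0 : x.1 = 0) : x.2 = 0 := by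
  obtain ⟨u, u', u'', hu, -, hr⟩ := hx
  ext1 i
  have hu0 : u i =ᵐ[volume.restrict (Ioc (P.a i) (P.b i))] 0 := by
    have h1 := (hr i).1
    rw [h0] at h1
    exact h1.symm.trans (Lp.coeFn_zero _ _ _)
  have hu1 := (isPrimitiveOn_zero (hu i).1 hu0).2
  have hu2 := (isPrimitiveOn_zero (hu i).2 hu1).2
  refine Lp.ext ?_
  filter_upwards [(hr i).2, hu0, hu2, Lp.coeFn_zero ℂ 2 (volume.restrict (Ioc (P.a i) (P.b i)))]
    with x h₁ h₂ h₃ h₄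
  simp only [Pi.zero_apply] at h₂ h₃
  rw [h₁, h₂, h₃]
  simpa using h₄.symm

/-- The operator `H^Ω_Γ` in `L²(Ω)`: it maps `u` to `-u'' + V u`, on the domain of all `u` in
`L²(Ω)` with `u`, `u'` absolutely continuous on every edge, `-u'' + V u ∈ L²(Ω)`, `γ_Γ u = 0`. -/
def operator (P : Problem ι) : P.L2 →ₗ.[ℂ] P.L2 := P.operatorGraph.toLinearPMap

/-- The graph of the operator is the intended one. -/
theorem operator_graph (P : Problem ι) : P.operator.graph = P.operatorGraph :=
  Submodule.toLinearPMap_graph_eq _ P.operatorGraph_functional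

/-- `u` (with derivative `u'`) solves `(H^Ω - z) u = 0`, `γ_Γ u = h`. -/
def Solves (P : Problem ι) (z : ℂ) (h : ι ⊕ ι → ℂ) (u u' : ι → ℝ → ℂ) : Prop :=
  (∃ u'' : ι → ℝ → ℂ, P.IsTwiceDiff u u' u'' ∧
    ∀ i, ∀ᵐ x ∂volume.restrict (Ioc (P.a i) (P.b i)),
      -u'' i x + (P.V i x : ℂ) * u i x - z * u i x = 0) ∧
  P.trace u u' = h

/-- `u` (with derivative `u'`) is the unique solution of `(H^Ω - z) u = 0`, `γ_Γ u = h`. -/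
def IsUniqueSolution (P : Problem ι) (z : ℂ) (h : ι ⊕ ι → ℂ) (u u' : ι → ℝ → ℂ) : Prop :=
  P.Solves z h u u' ∧
    ∀ v v' : ι → ℝ → ℂ, P.Solves z h v v' → ∀ i, EqOn (v i) (u i) (Icc (P.a i) (P.b i))

/-- Cutting edge `j` at the point `s`: the piece `[s, b j]` away from the common vertex, with the
Dirichlet condition at `s` and the old condition at `b j`. -/
def outerPiece (P : Problem ι) (j : ι) (s : ℝ) : Problem Unit where
  a := fun _ => s
  b := fun _ => P.b j
  V := fun _ => P.V j
  α₁ := 1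
  α₂ := 0
  β₁ := fun _ _ => P.β₁ j j
  β₂ := fun _ _ => P.β₂ j j

/-- Cutting edge `j` at the point `s`: the piece containing the common vertex. Edge `j` becomes
`[a j, s]` with the Dirichlet condition at `s`, everything else is unchanged. -/
def innerPiece (P : Problem ι) (j : ι) (s : ℝ) : Problem ι where
  a := P.a
  b := Function.update P.b j s
  V := P.V
  α₁ := P.α₁
  α₂ := P.α₂
  β₁ := P.β₁.updateRow j (Pi.single j 1)
  β₂ := P.β₂.updateRow j 0

end Problem

/-- The eigenspace of an unbounded operator `T` for `μ`, as a subspace of its domain. -/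
def eigenspace {E : Type*} [AddCommGroup E] [Module ℂ E] (T : E →ₗ.[ℂ] E) (μ : ℂ) :
    Submodule ℂ T.domain :=
  LinearMap.ker (T.toFun - μ • T.domain.subtype)

/-- `T` has only finitely many real eigenvalues `≤ lam`, each of finite multiplicity. -/
def HasFiniteCount {E : Type*} [AddCommGroup E] [Module ℂ E] (T : E →ₗ.[ℂ] E) (lam : ℝ) : Prop :=
  {μ : ℝ | μ ≤ lam ∧ eigenspace T (μ : ℂ) ≠ ⊥}.Finite ∧
    ∀ μ : ℝ, μ ≤ lam → FiniteDimensional ℂ (eigenspace T (μ : ℂ))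

/-- The counting function `𝒩_T(lam)`: the number of eigenvalues `≤ lam`, with multiplicity. -/
def eigenvalueCount {E : Type*} [AddCommGroup E] [Module ℂ E] (T : E →ₗ.[ℂ] E) (lam : ℝ) : ℕ :=
  ∑ᶠ μ ∈ Iic lam, Module.finrank ℂ (eigenspace T (μ : ℂ))

/-- The number of zeros `≤ lam` of a meromorphic function, with multiplicity. -/
def zeroCount (D : ℂ → ℂ) (lam : ℝ) : ℕ :=
  ∑ᶠ μ ∈ Iic lam, (meromorphicOrderAt D (μ : ℂ)).untop₀.toNat

/-- The number of poles `≤ lam` of a meromorphic function, with multiplicity. -/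
def poleCount (D : ℂ → ℂ) (lam : ℝ) : ℕ :=
  ∑ᶠ μ ∈ Iic lam, (-(meromorphicOrderAt D (μ : ℂ)).untop₀).toNat

/-- Both cuts on edge `j`: `M` is the matrix of `𝓜₁(z)`, where `R` is the middle piece
`[s₂, s₁]` with Dirichlet conditions. -/
def IsOneWireM₁ (R : Problem Unit) (z : ℂ) (M : Matrix (Fin 2) (Fin 2) ℂ) : Prop :=
  ∀ f : Fin 2 → ℂ, ∃ u u' : Unit → ℝ → ℂ,
    R.IsUniqueSolution z (Sum.elim (fun _ => f 0) (fun _ => f 1)) u u' ∧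
    M *ᵥ f = ![u' () (R.b ()), -u' () (R.a ())]

/-- Both cuts on edge `j`: `M` is the matrix of `𝓜₂(z)`, where `Q` is the outer piece `[s₁, ℓ j]`
and `S` is the piece containing the common vertex. -/
def IsOneWireM₂ {ι : Type} [Fintype ι] [DecidableEq ι] (Q : Problem Unit) (S : Problem ι) (j : ι)
    (z : ℂ) (M : Matrix (Fin 2) (Fin 2) ℂ) : Prop :=
  ∀ f : Fin 2 → ℂ, ∃ (u u' : Unit → ℝ → ℂ) (v v' : ι → ℝ → ℂ),
    Q.IsUniqueSolution z (Sum.elim 0 (fun _ => f 0)) u u' ∧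
    S.IsUniqueSolution z (Sum.elim (Pi.single j (f 1)) 0) v v' ∧
    M *ᵥ f = ![-u' () (Q.a ()), v' j (S.b j)]

/-- Cuts on two different edges `j`, `k`: `M` is the matrix of `𝓜₁(z)`, where `Q` and `R` are the
outer pieces `[s₁, ℓ j]` and `[s₂, ℓ k]`. -/
def IsTwoWireM₁ (Q R : Problem Unit) (z : ℂ) (M : Matrix (Fin 2) (Fin 2) ℂ) : Prop :=
  ∀ f : Fin 2 → ℂ, ∃ u u' v v' : Unit → ℝ → ℂ,
    Q.IsUniqueSolution z (Sum.elim 0 (fun _ => f 0)) u u' ∧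
    R.IsUniqueSolution z (Sum.elim 0 (fun _ => f 1)) v v' ∧
    M *ᵥ f = ![-u' () (Q.a ()), -v' () (R.a ())]

/-- Cuts on two different edges `j`, `k`: `M` is the matrix of `𝓜₂(z)`, where `S` is the piece
containing the common vertex. -/
def IsTwoWireM₂ {ι : Type} [Fintype ι] [DecidableEq ι] (S : Problem ι) (j k : ι)
    (z : ℂ) (M : Matrix (Fin 2) (Fin 2) ℂ) : Prop :=
  ∀ f : Fin 2 → ℂ, ∃ u u' : ι → ℝ → ℂ,
    S.IsUniqueSolution z (Sum.elim (Pi.single j (f 0) + Pi.single k (f 1)) 0) u u' ∧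
    M *ᵥ f = ![u' j (S.b j), u' k (S.b k)]

/-- The matrix `M` with `C M`; used only for predicates satisfied by at most one matrix (the value
`0` is used when there is none). -/
def theMatrix (C : Matrix (Fin 2) (Fin 2) ℂ → Prop) : Matrix (Fin 2) (Fin 2) ℂ :=
  open Classical in if h : ∃ M, C M then h.choose else 0

section Splitting

variable {ι : Type} [Fintype ι] [DecidableEq ι] (P : Problem ι) (j k : ι) (s₁ s₂ : ℝ)

/-- `Ω₁` with the conditions `Γ₁`. -/
def piece₁ : Problem Unit := P.outerPiece j s₁

/-- `Ω̃₁` with the conditions `Γ̃₁`: the first cut leaves `Ω₂`, whose edge `k` is cut at `s₂`. -/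
def piece₂ : Problem Unit := (P.innerPiece j s₁).outerPiece k s₂

/-- `Ω̃₂` with the conditions `Γ̃₂`. -/
def piece₃ : Problem ι := (P.innerPiece j s₁).innerPiece k s₂

/-- The Dirichlet-to-Neumann map `𝓜₁(z)`. -/
def bigM₁ (z : ℂ) : Matrix (Fin 2) (Fin 2) ℂ :=
  if j = k then theMatrix (IsOneWireM₁ (piece₂ P j k s₁ s₂) z)
  else theMatrix (IsTwoWireM₁ (piece₁ P j s₁) (piece₂ P j k s₁ s₂) z)

/-- The Dirichlet-to-Neumann map `𝓜₂(z)`. -/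
def bigM₂ (z : ℂ) : Matrix (Fin 2) (Fin 2) ℂ :=
  if j = k then theMatrix (IsOneWireM₂ (piece₁ P j s₁) (piece₃ P j k s₁ s₂) j z)
  else theMatrix (IsTwoWireM₂ (piece₃ P j k s₁ s₂) j k z)

/-- The determinant of the two-sided map `𝓜₁ + 𝓜₂`. -/
def twoSidedDet (z : ℂ) : ℂ :=
  (bigM₁ P j k s₁ s₂ z + bigM₂ P j k s₁ s₂ z).det

end Splitting

end
end QuantumStar

/-! A solution of the differential equation is determined by its Cauchy data `c` at the endpoints
joined at the common vertex. Sending `c` to the boundary trace of the solution gives a finite matrix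
`charMatrix`, entire in the spectral parameter. Its kernel is the eigenspace, and its determinant
`charFun` plays the role of a characteristic polynomial. The theorem amounts to the identity that
`twoSidedDet` is `charFun` of the whole graph divided by the product of `charFun` over the three
pieces. Comparing orders at each real point then gives the count.

Analytic side. The potentials are only integrable, so solutions come from inverting `1 - K` for a
Volterra operator `K` (`isUnit_one_sub_volterra`). `K` is affine in the spectral parameter, hence
solutions depend holomorphically on it. The order of a zero of `charFun` at a real point equals the
multiplicity of the eigenvalue: `meromorphicOrderAt_det` reduces this to the absence of Jordan
chains, which self-adjointness and Green's formula exclude (`IsRegular.transversal`). Non-real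
points are never zeros, and the energy identity bounds the real zeros from below
(`IsRegular.exists_lower_bound`). So all counts are finite.

Algebraic side. Cutting an edge moves no data at the common vertex. The matrices of the graph and of
the piece around the vertex therefore differ only in the rows of the cut edges. By the matrix
determinant lemma (`det_eq_det_mul_of_rows`) the quotient of their determinants is a determinant of
size two or one. Its entries carry the boundary values of unit Dirichlet solutions through the outer
pieces (`twoSidedDet_of_ne`, `twoSidedDet_of_eq`). -/

namespace QuantumStar

/-! ### Absolutely continuous functions -/

namespace IsPrimitiveOn

variable {a b : ℝ} {F f G g : ℝ → ℂ}

theorem continuousOn (hab : a ≤ b) (hF : IsPrimitiveOn a b F f) : ContinuousOn F (Icc a b) := by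
  have h := intervalIntegral.continuousOn_primitive_interval' (μ := volume) hF.1 left_mem_uIcc
  rw [uIcc_of_le hab] at h
  exact (continuousOn_const.add h).congr fun x hx => hF.2 x hx

theorem integral_eq (hab : a ≤ b) (hF : IsPrimitiveOn a b F f) : ∫ t in a..b, f t = F b - F a := by
  rw [hF.2 b (right_mem_Icc.2 hab)]
  ring

theorem congr (hab : a ≤ b) (hF : IsPrimitiveOn a b F f) (hG : EqOn G F (Icc a b))
    (hg : f =ᵐ[volume.restrict (Ioc a b)] g) : IsPrimitiveOn a b G g := by
  have hg' : f =ᵐ[volume.restrict (uIoc a b)] g := by rwa [uIoc_of_le hab]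
  refine ⟨hF.1.congr_ae hg', fun x hx => ?_⟩
  rw [hG hx, hG (left_mem_Icc.2 hab), hF.2 x hx]
  congr 1
  refine intervalIntegral.integral_congr_ae_restrict ?_
  rw [uIoc_of_le hx.1]
  exact ae_mono (Measure.restrict_mono (Ioc_subset_Ioc_right hx.2) le_rfl) hg

theorem mono {c d : ℝ} (hF : IsPrimitiveOn a b F f) (hac : a ≤ c) (hcd : c ≤ d) (hdb : d ≤ b) :
    IsPrimitiveOn c d F f := by
  have hsub : ∀ x y, a ≤ x → x ≤ b → a ≤ y → y ≤ b → IntervalIntegrable f volume x y := by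
    intro x y h1 h2 h3 h4
    refine hF.1.mono_set ?_
    rw [uIcc_of_le (h1.trans h2)]
    exact uIcc_subset_Icc ⟨h1, h2⟩ ⟨h3, h4⟩
  have hab : a ≤ b := (hac.trans hcd).trans hdb
  refine ⟨hsub c d hac (hcd.trans hdb) (hac.trans hcd) hdb, fun x hx => ?_⟩
  have hax : a ≤ x := hac.trans hx.1
  have hxb : x ≤ b := hx.2.trans hdb
  rw [hF.2 x ⟨hax, hxb⟩, hF.2 c ⟨hac, hcd.trans hdb⟩, add_assoc,
    intervalIntegral.integral_add_adjacent_intervals (hsub a c le_rfl hab hac (hcd.trans hdb))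
      (hsub c x hac (hcd.trans hdb) hax hxb)]

theorem const (c : ℂ) : IsPrimitiveOn a b (fun _ => c) (fun _ => 0) :=
  ⟨intervalIntegrable_const, fun x _ => by simp⟩

theorem conj (hF : IsPrimitiveOn a b F f) :
    IsPrimitiveOn a b (fun x => star (F x)) (fun x => star (f x)) := by
  refine ⟨?_, fun x hx => ?_⟩
  · have h := hF.1
    rw [intervalIntegrable_iff] at h ⊢
    exact (Complex.conjCLE.toContinuousLinearMap).integrable_comp h
  · beta_reduce
    rw [hF.2 x hx, star_add]
    congr 1
    have hx' : IntervalIntegrable f volume a x := by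
      refine hF.1.mono_set ?_
      rw [uIcc_of_le hx.1, uIcc_of_le (hx.1.trans hx.2)]
      exact Icc_subset_Icc_right hx.2
    exact ((Complex.conjCLE.toContinuousLinearMap).intervalIntegral_comp_comm hx').symm

/-- The increments of `F` are dominated by those of the primitive of `‖f‖`, so the same `δ` serves
for both. -/
theorem absolutelyContinuousOnInterval (hab : a ≤ b) (hF : IsPrimitiveOn a b F f) :
    AbsolutelyContinuousOnInterval F a b := by
  have hn := (hF.1.norm).absolutelyContinuousOnInterval_intervalIntegral
    (c := a) left_mem_uIcc
  rw [absolutelyContinuousOnInterval_iff] at hn ⊢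
  intro ε hε
  obtain ⟨δ, hδ, h⟩ := hn ε hε
  refine ⟨δ, hδ, fun E hE hs => (Finset.sum_le_sum fun i hi => ?_).trans_lt (h E hE hs)⟩
  obtain ⟨h1, h2⟩ := hE.1 i hi
  rw [uIcc_of_le hab] at h1 h2
  have hsub : ∀ {x}, x ∈ Icc a b → IntervalIntegrable f volume a x := by
    intro x hx
    refine hF.1.mono_set ?_
    rw [uIcc_of_le hx.1, uIcc_of_le hab]
    exact Icc_subset_Icc_right hx.2
  rw [dist_eq_norm, dist_eq_norm, hF.2 _ h1, hF.2 _ h2, add_sub_add_left_eq_sub,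
    intervalIntegral.integral_interval_sub_left (hsub h1) (hsub h2),
    intervalIntegral.integral_interval_sub_left (hsub h1).norm (hsub h2).norm, Real.norm_eq_abs]
  exact intervalIntegral.norm_integral_le_abs_integral_norm

theorem ae_hasDerivAt (hab : a ≤ b) (hF : IsPrimitiveOn a b F f) :
    ∀ᵐ x, x ∈ Ioo a b → HasDerivAt F (f x) x := by
  filter_upwards [hF.1.ae_hasDerivAt_integral] with x hx hxm
  have h := hx (by rw [uIcc_of_le hab]; exact Ioo_subset_Icc_self hxm) a left_mem_uIcc
  refine (h.const_add (F a)).congr_of_eventuallyEq ?_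
  filter_upwards [Icc_mem_nhds hxm.1 hxm.2] with y hy
  exact hF.2 y hy

/-- The difference of `F` and the integral of `f` is absolutely continuous with derivative zero
almost everywhere, hence constant. This converse reduces the product rule to a pointwise
computation. -/
theorem of_hasDerivAt (hab : a ≤ b) (hF : AbsolutelyContinuousOnInterval F a b)
    (hi : IntervalIntegrable f volume a b)
    (hd : ∀ᵐ x, x ∈ Ioo a b → HasDerivAt F (f x) x) : IsPrimitiveOn a b F f := by
  refine ⟨hi, fun x hx => ?_⟩
  have hI : IsPrimitiveOn a b (fun x => ∫ t in a..x, f t) f := ⟨hi, fun x _ => by simp⟩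
  have hsub := hF.sub (hI.absolutelyContinuousOnInterval hab)
  have hend : ∀ᵐ x : ℝ, x ≠ a ∧ x ≠ b := by
    have h1 : ∀ c : ℝ, ∀ᵐ x : ℝ, x ≠ c := fun c => by
      simp [ae_iff]
    exact (h1 a).and (h1 b)
  obtain ⟨C, hC⟩ := hsub.const_of_ae_hasDerivAt_zero (by
    filter_upwards [hd, hI.ae_hasDerivAt hab, hend] with y h1 h2 h3 hy
    rw [uIcc_of_le hab] at hy
    have hy' : y ∈ Ioo a b := ⟨lt_of_le_of_ne hy.1 h3.1.symm, lt_of_le_of_ne hy.2 h3.2⟩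
    have h := (h1 hy').sub (h2 hy')
    rwa [sub_self] at h)
  rw [uIcc_of_le hab] at hC
  have h1 := hC x hx
  have h2 := hC a (left_mem_Icc.2 hab)
  simp only [Pi.sub_apply, intervalIntegral.integral_same, sub_zero] at h1 h2
  rw [h2, ← h1]
  ring

/-- The product rule. -/
theorem mul (hab : a ≤ b) (hF : IsPrimitiveOn a b F f) (hG : IsPrimitiveOn a b G g) :
    IsPrimitiveOn a b (fun x => F x * G x) (fun x => f x * G x + F x * g x) := by
  refine of_hasDerivAt hab ?_ ?_ ?_
  · exact (hF.absolutelyContinuousOnInterval hab).smul (hG.absolutelyContinuousOnInterval hab)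
  · have h1 := hF.continuousOn hab
    have h2 := hG.continuousOn hab
    rw [← uIcc_of_le hab] at h1 h2
    exact (hF.1.mul_continuousOn h2).add (hG.1.continuousOn_mul h1)
  · filter_upwards [hF.ae_hasDerivAt hab, hG.ae_hasDerivAt hab] with x h1 h2 hx
    exact (h1 hx).mul (h2 hx)

theorem pow (hab : a ≤ b) (hF : IsPrimitiveOn a b F f) (n : ℕ) :
    IsPrimitiveOn a b (fun x => F x ^ (n + 1)) (fun x => (n + 1) * (f x * F x ^ n)) := by
  induction n with
  | zero => simpa using hF
  | succ n ih =>
    have h := ih.mul hab hF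
    convert h using 2 with x
    · ring
    · push_cast
      ring

/-- Two primitives with the same value at `a` and a.e. equal derivatives agree. -/
theorem ext (hF : IsPrimitiveOn a b F f) (hG : IsPrimitiveOn a b G g) (h0 : F a = G a)
    (hfg : f =ᵐ[volume.restrict (Ioc a b)] g) : EqOn F G (Icc a b) := by
  intro x hx
  rw [hF.2 x hx, hG.2 x hx, h0]
  congr 1
  refine intervalIntegral.integral_congr_ae_restrict ?_
  rw [uIoc_of_le hx.1]
  exact ae_mono (Measure.restrict_mono (Ioc_subset_Ioc_right hx.2) le_rfl) hfg

end IsPrimitiveOn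

end QuantumStar

namespace QuantumStar

/-! ### Volterra operators -/

section Volterra

open scoped BoundedContinuousFunction

variable {E : Type*} [NormedAddCommGroup E] [NormedSpace ℂ E]

theorem integrable_clm_apply {A : ℝ → E →L[ℂ] E} (hA : Integrable A) (Y : ℝ →ᵇ E) :
    Integrable fun t => A t (Y t) := by
  refine (hA.norm.mul_const ‖Y‖).mono' ?_ (Filter.Eventually.of_forall fun t => ?_)
  · exact (ContinuousLinearMap.id ℂ (E →L[ℂ] E)).aestronglyMeasurable_comp₂ hA.1
      Y.continuous.aestronglyMeasurable
  · exact ((A t).le_opNorm _).trans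
      (mul_le_mul_of_nonneg_left (Y.norm_coe_le_norm t) (norm_nonneg _))

theorem norm_integral_Iic_clm_apply_le {A : ℝ → E →L[ℂ] E} (hA : Integrable A) (Y : ℝ →ᵇ E)
    (x : ℝ) : ‖∫ t in Iic x, A t (Y t)‖ ≤ (∫ t, ‖A t‖) * ‖Y‖ := by
  rw [← integral_mul_const]
  refine (norm_integral_le_of_norm_le (hA.norm.mul_const ‖Y‖).integrableOn
    (Filter.Eventually.of_forall fun t => ?_)).trans
    (setIntegral_le_integral (hA.norm.mul_const ‖Y‖)
      (Filter.Eventually.of_forall fun t => by positivity))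
  exact ((A t).le_opNorm _).trans
      (mul_le_mul_of_nonneg_left (Y.norm_coe_le_norm t) (norm_nonneg _))

theorem continuous_integral_Iic {F : Type*} [NormedAddCommGroup F] [NormedSpace ℝ F]
    {f : ℝ → F} (hf : Integrable f) :
    Continuous fun x => ∫ t in Iic x, f t := by
  have h : (fun x => ∫ t in Iic x, f t) =
      fun x => (∫ t in (0 : ℝ)..x, f t) + ∫ t in Iic 0, f t := by
    funext x
    rw [← intervalIntegral.integral_Iic_sub_Iic hf.integrableOn hf.integrableOn]
    abel
  rw [h]
  exact (intervalIntegral.continuous_primitive (fun _ _ => hf.intervalIntegrable) 0).add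
    continuous_const

/-- The Volterra operator `(K Y)(x) = ∫_{-∞}^x A(t) Y(t) dt` on bounded continuous functions. -/
noncomputable def volterra (A : ℝ → E →L[ℂ] E) (hA : Integrable A) :
    (ℝ →ᵇ E) →L[ℂ] (ℝ →ᵇ E) :=
  LinearMap.mkContinuous
    { toFun := fun Y => BoundedContinuousFunction.ofNormedAddCommGroup
        (fun x => ∫ t in Iic x, A t (Y t)) (continuous_integral_Iic (integrable_clm_apply hA Y))
        ((∫ t, ‖A t‖) * ‖Y‖) (norm_integral_Iic_clm_apply_le hA Y)
      map_add' := fun Y Z => by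
        ext1 x
        simp only [BoundedContinuousFunction.coe_ofNormedAddCommGroup,
          BoundedContinuousFunction.coe_add, Pi.add_apply, map_add]
        exact integral_add (integrable_clm_apply hA Y).integrableOn
          (integrable_clm_apply hA Z).integrableOn
      map_smul' := fun c Y => by
        ext1 x
        simp only [BoundedContinuousFunction.coe_ofNormedAddCommGroup,
          BoundedContinuousFunction.coe_smul, map_smul, RingHom.id_apply]
        exact integral_smul c _ }
    (∫ t, ‖A t‖) fun Y => by
      exact BoundedContinuousFunction.norm_ofNormedAddCommGroup_le _ (by positivity)
        (norm_integral_Iic_clm_apply_le hA Y)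

theorem volterra_apply (A : ℝ → E →L[ℂ] E) (hA : Integrable A) (Y : ℝ →ᵇ E) (x : ℝ) :
    volterra A hA Y x = ∫ t in Iic x, A t (Y t) := rfl

variable {A : ℝ → E →L[ℂ] E} {a : ℝ}

theorem integral_Iic_eq_intervalIntegral {F : Type*} [NormedAddCommGroup F] [NormedSpace ℝ F]
    {f : ℝ → F} (hf : Integrable f) (h0 : ∀ t ≤ a, f t = 0) (x : ℝ) :
    ∫ t in Iic x, f t = ∫ t in a..x, f t := by
  have h : ∫ t in Iic a, f t = 0 := by
    rw [setIntegral_congr_fun measurableSet_Iic (g := fun _ => 0) (fun t ht => h0 t ht)]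
    simp
  rw [← intervalIntegral.integral_Iic_sub_Iic hf.integrableOn hf.integrableOn, h, sub_zero]

/-- With `G` the running integral of `‖A‖`, the integrand is the derivative of `G ^ (n + 1) / (n +
1)`, and `G a = 0`. The computation passes through `ℂ`, where the power rule is available. -/
theorem integral_norm_mul_pow (hA : Integrable A) (h0 : ∀ t ≤ a, A t = 0) {x : ℝ} (hx : a ≤ x)
    (n : ℕ) :
    ∫ t in a..x, ‖A t‖ * (∫ s in Iic t, ‖A s‖) ^ n = (∫ s in Iic x, ‖A s‖) ^ (n + 1) / (n + 1) := by
  have hG : ∀ t, ∫ s in Iic t, ‖A s‖ = ∫ s in a..t, ‖A s‖ :=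
    integral_Iic_eq_intervalIntegral hA.norm fun t ht => by simp [h0 t ht]
  have hp : IsPrimitiveOn a x (fun t => ((∫ s in Iic t, ‖A s‖ : ℝ) : ℂ))
      (fun t => ((‖A t‖ : ℝ) : ℂ)) := by
    refine ⟨(hA.norm.ofReal (𝕜 := ℂ)).intervalIntegrable, fun t _ => ?_⟩
    simp only [hG, intervalIntegral.integral_same, intervalIntegral.integral_ofReal]
    simp
  have h := (hp.pow hx n).integral_eq hx
  have ha : ∫ s in Iic a, ‖A s‖ = 0 := by rw [hG, intervalIntegral.integral_same]
  rw [intervalIntegral.integral_const_mul, ha] at h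
  have hn : (n + 1 : ℂ) ≠ 0 := by exact_mod_cast Nat.succ_ne_zero n
  rw [← Complex.ofReal_inj, ← intervalIntegral.integral_ofReal]
  push_cast at h ⊢
  rw [eq_div_iff hn, mul_comm, h]
  simp

/-- The usual iterated-kernel estimate. The bound must be pointwise in `x`: the factorial appears by
integrating the previous bound against `‖A‖`. -/
theorem norm_volterra_pow_apply_le (hA : Integrable A) (h0 : ∀ t ≤ a, A t = 0) (n : ℕ)
    (Y : ℝ →ᵇ E) (x : ℝ) :
    ‖(volterra A hA ^ n) Y x‖ ≤ (∫ s in Iic x, ‖A s‖) ^ n / n.factorial * ‖Y‖ := by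
  have hG := continuous_integral_Iic hA.norm
  induction n generalizing x with
  | zero => simpa using Y.norm_coe_le_norm x
  | succ n ih =>
    rw [pow_succ', mul_apply_eq_comp, volterra_apply]
    have hz : ∀ t ≤ a, A t ((volterra A hA ^ n) Y t) = 0 := fun t ht => by simp [h0 t ht]
    rcases le_or_gt a x with hx | hx
    · rw [integral_Iic_eq_intervalIntegral (integrable_clm_apply hA _) hz]
      have hint : IntervalIntegrable
          (fun t => ‖A t‖ * (∫ s in Iic t, ‖A s‖) ^ n * (‖Y‖ / n.factorial)) volume a x :=
        ((hA.norm.intervalIntegrable).mul_continuousOn (hG.pow n).continuousOn).mul_const _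
      refine (intervalIntegral.norm_integral_le_of_norm_le hx
        (Filter.Eventually.of_forall fun t _ => ?_) hint).trans ?_
      · refine ((A t).le_opNorm _).trans ?_
        rw [mul_assoc]
        refine mul_le_mul_of_nonneg_left ((ih t).trans_eq ?_) (norm_nonneg _)
        ring
      · rw [intervalIntegral.integral_mul_const, integral_norm_mul_pow hA h0 hx,
          Nat.factorial_succ]
        push_cast
        refine le_of_eq ?_
        field_simp
    · have : ∫ t in Iic x, A t ((volterra A hA ^ n) Y t) = 0 := by
        rw [setIntegral_congr_fun measurableSet_Iic (g := fun _ => 0)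
          (fun t ht => hz t (le_trans ht hx.le))]
        simp
      rw [this, norm_zero]
      have : 0 ≤ ∫ s in Iic x, ‖A s‖ := integral_nonneg fun _ => norm_nonneg _
      positivity

theorem isUnit_one_sub_volterra [CompleteSpace E] (hA : Integrable A) (h0 : ∀ t ≤ a, A t = 0) :
    IsUnit (1 - volterra A hA) := by
  obtain ⟨n, hn⟩ := ((FloorSemiring.tendsto_pow_div_factorial_atTop (∫ s, ‖A s‖)).eventually
    (gt_mem_nhds one_pos)).exists
  have hnorm : ‖volterra A hA ^ n‖ < 1 := by
    refine (ContinuousLinearMap.opNorm_le_bound _ ?_ fun Y => ?_).trans_lt hn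
    · have : 0 ≤ ∫ s, ‖A s‖ := integral_nonneg fun _ => norm_nonneg _
      positivity
    · have h1 : 0 ≤ ∫ s, ‖A s‖ := integral_nonneg fun _ => norm_nonneg _
      refine (BoundedContinuousFunction.norm_le (by positivity)).2 fun x => ?_
      refine (norm_volterra_pow_apply_le hA h0 n Y x).trans ?_
      have h2 : 0 ≤ ∫ s in Iic x, ‖A s‖ := integral_nonneg fun _ => norm_nonneg _
      have h3 : ∫ s in Iic x, ‖A s‖ ≤ ∫ s, ‖A s‖ :=
        setIntegral_le_integral hA.norm (Filter.Eventually.of_forall fun t => norm_nonneg _)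
      gcongr
  -- Only a power of the operator is a contraction. The geometric sum factors `1 - K ^ n` through `1
  -- - K`, and a factor of a unit is a unit when the factors commute.
  have hu : IsUnit ((1 - volterra A hA) * ∑ i ∈ Finset.range n, volterra A hA ^ i) := by
    rw [mul_neg_geom_sum]
    exact isUnit_one_sub_of_norm_lt_one hnorm
  have hc : Commute (1 - volterra A hA) (∑ i ∈ Finset.range n, volterra A hA ^ i) := by
    rw [Commute, SemiconjBy, mul_neg_geom_sum, geom_sum_mul_neg]
  exact (hc.isUnit_mul_iff.1 hu).1

end Volterra

end QuantumStar

namespace QuantumStar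

/-! ### The initial value problem on one edge -/

/-- `u` (with derivative `v`) solves `-u'' + q u = z u` on `[a, b]`. -/
def IsEdgeSol (a b : ℝ) (q : ℝ → ℝ) (z : ℂ) (u v : ℝ → ℂ) : Prop :=
  IsPrimitiveOn a b u v ∧ IsPrimitiveOn a b v (fun t => ((q t : ℂ) - z) * u t)

namespace IsEdgeSol

variable {a b : ℝ} {q : ℝ → ℝ} {z ζ : ℂ} {u v y w : ℝ → ℂ}

theorem mono (h : IsEdgeSol a b q z u v) {c d : ℝ} (hac : a ≤ c) (hcd : c ≤ d) (hdb : d ≤ b) :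
    IsEdgeSol c d q z u v :=
  ⟨h.1.mono hac hcd hdb, h.2.mono hac hcd hdb⟩

/-- The potential terms cancel in the derivative because both solutions share the same spectral
parameter. -/
theorem wronskian (hab : a ≤ b) (h : IsEdgeSol a b q z u v) (h' : IsEdgeSol a b q z y w) {x : ℝ}
    (hx : x ∈ Icc a b) : u x * w x - v x * y x = u a * w a - v a * y a := by
  have h1 := h.1.mul hab h'.2
  have h2 := h.2.mul hab h'.1
  have h3 := isPrimitiveOn_add h1 (isPrimitiveOn_smul (-1) h2)
  have h4 := h3.ext (IsPrimitiveOn.const (u a * w a - v a * y a)) (by simp; ring)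
    (Filter.Eventually.of_forall fun t => by simp; ring) hx
  simp only [Pi.add_apply, Pi.smul_apply, smul_eq_mul] at h4
  linear_combination h4

/-- Green's formula. -/
theorem green (hab : a ≤ b) (h : IsEdgeSol a b q z u v) (h' : IsEdgeSol a b q ζ y w) :
    (star (y b) * v b - star (w b) * u b) - (star (y a) * v a - star (w a) * u a) =
      (star ζ - z) * ∫ t in a..b, star (y t) * u t := by
  have h1 := h'.1.conj.mul hab h.2
  have h2 := h'.2.conj.mul hab h.1
  have h3 := isPrimitiveOn_add h1 (isPrimitiveOn_smul (-1) h2)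
  rw [← intervalIntegral.integral_const_mul]
  have h4 := h3.integral_eq hab
  simp only [Pi.add_apply, Pi.smul_apply, smul_eq_mul] at h4
  have h5 : ∫ t in a..b, (star ζ - z) * (star (y t) * u t) =
      ∫ t in a..b, (star (w t) * v t + star (y t) * (((q t : ℂ) - z) * u t) +
        -1 * (star (((q t : ℂ) - ζ) * y t) * u t + star (w t) * v t)) := by
    refine intervalIntegral.integral_congr fun t _ => ?_
    have : star (q t : ℂ) = q t := Complex.conj_ofReal _
    simp only [star_mul', star_sub, this]
    ring
  rw [h5, h4]
  ring

/-- The energy identity. -/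
theorem energy (hab : a ≤ b) (h : IsEdgeSol a b q z u v) :
    star (u b) * v b - star (u a) * v a =
      ∫ t in a..b, (star (v t) * v t + star (u t) * (((q t : ℂ) - z) * u t)) := by
  rw [(h.1.conj.mul hab h.2).integral_eq hab]

/-- A solution is determined by its data at the left endpoint. -/
theorem eq_combination (hab : a ≤ b) (h : IsEdgeSol a b q z u v) {c c' s s' : ℝ → ℂ}
    (hc : IsEdgeSol a b q z c c') (hs : IsEdgeSol a b q z s s') (hca : c a = 1) (hca' : c' a = 0)
    (hsa : s a = 0) (hsa' : s' a = 1) {x : ℝ} (hx : x ∈ Icc a b) :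
    u x = u a * c x + v a * s x ∧ v x = u a * c' x + v a * s' x := by
  have h1 := h.wronskian hab hs hx
  have h2 := h.wronskian hab hc hx
  have h3 := hc.wronskian hab hs hx
  rw [hca, hca', hsa, hsa'] at *
  constructor
  · linear_combination (-u x) * h3 + c x * h1 - s x * h2
  · linear_combination (-v x) * h3 + c' x * h1 - s' x * h2

end IsEdgeSol

/-! ### Existence, uniqueness and holomorphic dependence for the initial value problem. -/

section EdgeSol

open scoped BoundedContinuousFunction

/-- The coefficient matrix of the first order system, cut off outside `(a, b]`. -/
noncomputable def edgeCoeff (a b : ℝ) (q : ℝ → ℂ) : ℝ → (ℂ × ℂ →L[ℂ] ℂ × ℂ) :=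
  (Ioc a b).indicator fun t => (ContinuousLinearMap.inl ℂ ℂ ℂ) ∘L (ContinuousLinearMap.snd ℂ ℂ ℂ) +
    q t • (ContinuousLinearMap.inr ℂ ℂ ℂ) ∘L (ContinuousLinearMap.fst ℂ ℂ ℂ)

/-- The derivative of `-edgeCoeff` with respect to the spectral parameter. -/
noncomputable def edgeShift (a b : ℝ) : ℝ → (ℂ × ℂ →L[ℂ] ℂ × ℂ) :=
  (Ioc a b).indicator fun _ => (ContinuousLinearMap.inr ℂ ℂ ℂ) ∘L (ContinuousLinearMap.fst ℂ ℂ ℂ)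

variable {a b : ℝ} {q : ℝ → ℝ}

theorem integrable_indicator_const_add_smul {E : Type*} [NormedAddCommGroup E] [NormedSpace ℂ E]
    (M N : E) {q : ℝ → ℂ} (hab : a ≤ b) (hq : IntervalIntegrable q volume a b) :
    Integrable ((Ioc a b).indicator fun t => M + q t • N) := by
  rw [intervalIntegrable_iff_integrableOn_Ioc_of_le hab] at hq
  have h : IntegrableOn (fun t => M + q t • N) (Ioc a b) :=
    (integrable_const M).add (hq.smul_const N)
  exact h.integrable_indicator measurableSet_Ioc

theorem integrable_indicator_Ioc_const {E : Type*} [NormedAddCommGroup E] (M : E) (a b : ℝ) :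
    Integrable ((Ioc a b).indicator fun _ => M) := by
  have h : IntegrableOn (fun _ => M) (Ioc a b) := integrable_const M
  exact h.integrable_indicator measurableSet_Ioc

theorem integrable_edgeCoeff {q : ℝ → ℂ} (hab : a ≤ b) (hq : IntervalIntegrable q volume a b) :
    Integrable (edgeCoeff a b q) :=
  integrable_indicator_const_add_smul _ _ hab hq

theorem integrable_edgeShift (a b : ℝ) : Integrable (edgeShift a b) :=
  integrable_indicator_Ioc_const _ a b

theorem edgeCoeff_of_le {q : ℝ → ℂ} {t : ℝ} (ht : t ≤ a) : edgeCoeff a b q t = 0 :=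
  indicator_of_notMem (fun h => absurd h.1 (not_lt.2 ht)) _

open Classical in
/-- The pair `(u, u')` with `-u'' + q u = z u` on `[a, b]` and `(u, u')(a) = c`. -/
noncomputable def edgeSol (a b : ℝ) (q : ℝ → ℝ) (z : ℂ) : (ℂ × ℂ) →ₗ[ℂ] (ℝ →ᵇ ℂ × ℂ) :=
  if h : Integrable (edgeCoeff a b fun t => (q t : ℂ)) then
    (Ring.inverse (1 - (volterra _ h - z • volterra _ (integrable_edgeShift a b)))).toLinearMap ∘ₗ
      { toFun := fun c => BoundedContinuousFunction.const ℝ c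
        map_add' := fun _ _ => rfl
        map_smul' := fun _ _ => rfl }
  else 0

theorem edgeSol_eq_inverse (h : Integrable (edgeCoeff a b fun t => (q t : ℂ))) (z : ℂ)
    (c : ℂ × ℂ) : edgeSol a b q z c =
      (Ring.inverse (1 - (volterra _ h - z • volterra _ (integrable_edgeShift a b))) :
        (ℝ →ᵇ ℂ × ℂ) →L[ℂ] (ℝ →ᵇ ℂ × ℂ)) (BoundedContinuousFunction.const ℝ c) := by
  rw [edgeSol, dif_pos h]
  rfl

theorem intervalIntegrable_sub_const (hq : IntervalIntegrable q volume a b) (z : ℂ) :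
    IntervalIntegrable (fun t => (q t : ℂ) - z) volume a b := by
  refine IntervalIntegrable.sub ?_ intervalIntegrable_const
  rw [intervalIntegrable_iff] at hq ⊢
  exact hq.ofReal

/-- The left side displays the affine dependence on `z` needed for holomorphy; the right side is a
single Volterra operator, which gives invertibility. -/
theorem volterra_sub_smul (hab : a ≤ b) (hq : IntervalIntegrable q volume a b) (z : ℂ)
    (h : Integrable (edgeCoeff a b fun t => (q t : ℂ))) :
    volterra _ h - z • volterra _ (integrable_edgeShift a b) =
      volterra _ (integrable_edgeCoeff hab (intervalIntegrable_sub_const hq z)) := by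
  ext1 Y
  refine BoundedContinuousFunction.ext fun x => ?_
  simp only [sub_apply, smul_apply,
    BoundedContinuousFunction.coe_sub, BoundedContinuousFunction.coe_smul, Pi.sub_apply,
    volterra_apply]
  have hi : Integrable fun t => z • edgeShift a b t (Y t) :=
    (integrable_clm_apply (integrable_edgeShift a b) Y).smul z
  rw [← integral_smul, ← integral_sub (integrable_clm_apply h Y).integrableOn hi.integrableOn]
  congr 1 with t
  · by_cases ht : t ∈ Ioc a b <;> simp [edgeCoeff, edgeShift, ht]
  · by_cases ht : t ∈ Ioc a b <;> simp [edgeCoeff, edgeShift, ht]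
    ring

theorem isUnit_edge (hab : a ≤ b) (hq : IntervalIntegrable q volume a b) (z : ℂ)
    (h : Integrable (edgeCoeff a b fun t => (q t : ℂ))) :
    IsUnit (1 - (volterra _ h - z • volterra _ (integrable_edgeShift a b))) := by
  rw [volterra_sub_smul hab hq z h]
  exact isUnit_one_sub_volterra _ (a := a) fun t ht => edgeCoeff_of_le ht

theorem integrable_edgeCoeff_ofReal (hab : a ≤ b) (hq : IntervalIntegrable q volume a b) :
    Integrable (edgeCoeff a b fun t => (q t : ℂ)) := by
  simpa using integrable_edgeCoeff hab (intervalIntegrable_sub_const hq 0)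

/-- Inversion is differentiable at units and the inverted operator is affine in `z`.
Differentiability holds in the sup norm, so it also yields joint continuity in `z` and `x`. -/
theorem differentiable_edgeSol (hab : a ≤ b) (hq : IntervalIntegrable q volume a b) (c : ℂ × ℂ) :
    Differentiable ℂ fun z => edgeSol a b q z c := by
  intro z
  have h := integrable_edgeCoeff_ofReal hab hq
  have h1 : DifferentiableAt ℂ (fun z => Ring.inverse
      (1 - (volterra _ h - z • volterra _ (integrable_edgeShift a b)))) z := by
    have h2 : DifferentiableAt ℂ
        (fun z => 1 - (volterra _ h - z • volterra _ (integrable_edgeShift a b))) z := by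
      fun_prop
    exact DifferentiableAt.comp (g := Ring.inverse) z
      (differentiableAt_inverse (isUnit_edge hab hq z h)) h2
  have h2 := h1.clm_apply (differentiableAt_const (BoundedContinuousFunction.const ℝ c))
  refine h2.congr_of_eventuallyEq (Filter.Eventually.of_forall fun w => ?_)
  exact edgeSol_eq_inverse h w c

theorem edgeSol_apply_eq (hab : a ≤ b) (hq : IntervalIntegrable q volume a b) (z : ℂ)
    (c : ℂ × ℂ) {x : ℝ} (hx : x ∈ Icc a b) :
    edgeSol a b q z c x = c + ∫ t in a..x,
      ((edgeSol a b q z c t).2, ((q t : ℂ) - z) * (edgeSol a b q z c t).1) := by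
  have h := integrable_edgeCoeff_ofReal hab hq
  have h1 : (1 - (volterra _ h - z • volterra _ (integrable_edgeShift a b)))
      (edgeSol a b q z c) = BoundedContinuousFunction.const ℝ c := by
    have h2 := Ring.mul_inverse_cancel _ (isUnit_edge hab hq z h)
    have h3 := congrArg (fun T => T (BoundedContinuousFunction.const ℝ c)) h2
    rw [edgeSol_eq_inverse h]
    exact h3
  rw [volterra_sub_smul hab hq z h] at h1
  have h2 := congrArg (fun Y : ℝ →ᵇ ℂ × ℂ => Y x) h1
  simp only [sub_apply, one_apply_eq_self,
    BoundedContinuousFunction.coe_sub, Pi.sub_apply, volterra_apply,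
    BoundedContinuousFunction.const_apply] at h2
  rw [integral_Iic_eq_intervalIntegral (a := a) (integrable_clm_apply
    (integrable_edgeCoeff hab (intervalIntegrable_sub_const hq z)) _)
    (fun t ht => by rw [edgeCoeff_of_le ht]; rfl)] at h2
  rw [sub_eq_iff_eq_add] at h2
  rw [h2]
  congr 1
  refine intervalIntegral.integral_congr_ae (Filter.Eventually.of_forall fun t ht => ?_)
  rw [uIoc_of_le hx.1] at ht
  have ht' : t ∈ Ioc a b := ⟨ht.1, ht.2.trans hx.2⟩
  simp [edgeCoeff, ht']

theorem edgeSol_left (hab : a ≤ b) (hq : IntervalIntegrable q volume a b) (z : ℂ)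
    (c : ℂ × ℂ) : edgeSol a b q z c a = c := by
  rw [edgeSol_apply_eq hab hq z c (left_mem_Icc.2 hab)]
  simp

theorem isEdgeSol_edgeSol (hab : a ≤ b) (hq : IntervalIntegrable q volume a b) (z : ℂ)
    (c : ℂ × ℂ) : IsEdgeSol a b q z (fun x => (edgeSol a b q z c x).1)
      (fun x => (edgeSol a b q z c x).2) := by
  have hc1 : Continuous fun x => (edgeSol a b q z c x).1 :=
    continuous_fst.comp (edgeSol a b q z c).continuous
  have hc2 : Continuous fun x => (edgeSol a b q z c x).2 :=
    continuous_snd.comp (edgeSol a b q z c).continuous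
  have hi1 : IntervalIntegrable (fun x => (edgeSol a b q z c x).2) volume a b :=
    hc2.intervalIntegrable _ _
  have hi2 : IntervalIntegrable (fun x => ((q x : ℂ) - z) * (edgeSol a b q z c x).1) volume a b :=
    (intervalIntegrable_sub_const hq z).mul_continuousOn hc1.continuousOn
  have hsub : ∀ {f : ℝ → ℂ} {x : ℝ}, x ∈ Icc a b → IntervalIntegrable f volume a b →
      IntervalIntegrable f volume a x := by
    intro f x hx hf
    refine hf.mono_set ?_
    rw [uIcc_of_le hx.1, uIcc_of_le hab]
    exact Icc_subset_Icc_right hx.2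
  have key : ∀ x ∈ Icc a b, ∫ t in a..x,
      ((edgeSol a b q z c t).2, ((q t : ℂ) - z) * (edgeSol a b q z c t).1) =
      (∫ t in a..x, (edgeSol a b q z c t).2,
        ∫ t in a..x, ((q t : ℂ) - z) * (edgeSol a b q z c t).1) := by
    intro x hx
    have h1 := hsub hx hi1
    have h2 := hsub hx hi2
    simp only [intervalIntegral.integral_of_le hx.1]
    rw [intervalIntegrable_iff_integrableOn_Ioc_of_le hx.1] at h1 h2
    exact integral_pair h1 h2
  refine ⟨⟨hi1, fun x hx => ?_⟩, ⟨hi2, fun x hx => ?_⟩⟩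
  · beta_reduce
    rw [edgeSol_left hab hq, edgeSol_apply_eq hab hq z c hx, key x hx]
    rfl
  · beta_reduce
    rw [edgeSol_left hab hq, edgeSol_apply_eq hab hq z c hx, key x hx]
    rfl

/-- Uniqueness for the initial value problem. -/
theorem IsEdgeSol.eq_edgeSol (hab : a ≤ b) (hq : IntervalIntegrable q volume a b) {z : ℂ}
    {u v : ℝ → ℂ} (h : IsEdgeSol a b q z u v) {x : ℝ} (hx : x ∈ Icc a b) :
    u x = (edgeSol a b q z (u a, v a) x).1 ∧ v x = (edgeSol a b q z (u a, v a) x).2 := by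
  have hc := isEdgeSol_edgeSol hab hq z (1, 0)
  have hs := isEdgeSol_edgeSol hab hq z (0, 1)
  have h' := isEdgeSol_edgeSol hab hq z (u a, v a)
  have e1 := h.eq_combination hab hc hs (by simp [edgeSol_left hab hq]) (by simp [edgeSol_left hab hq])
    (by simp [edgeSol_left hab hq]) (by simp [edgeSol_left hab hq]) hx
  have e2 := h'.eq_combination hab hc hs (by simp [edgeSol_left hab hq]) (by simp [edgeSol_left hab hq])
    (by simp [edgeSol_left hab hq]) (by simp [edgeSol_left hab hq]) hx
  simp only [edgeSol_left hab hq] at e2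
  exact ⟨e1.1.trans e2.1.symm, e1.2.trans e2.2.symm⟩

theorem edgeSol_restrict {s : ℝ} (has : a ≤ s) (hsb : s ≤ b)
    (hq : IntervalIntegrable q volume a b) (z : ℂ) (c : ℂ × ℂ) {x : ℝ} (hx : x ∈ Icc a s) :
    edgeSol a b q z c x = edgeSol a s q z c x := by
  have hq' : IntervalIntegrable q volume a s := hq.mono_set (by
    rw [uIcc_of_le has, uIcc_of_le (has.trans hsb)]
    exact Icc_subset_Icc_right hsb)
  have h := ((isEdgeSol_edgeSol (has.trans hsb) hq z c).mono le_rfl has hsb).eq_edgeSol has hq' hx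
  simp only [edgeSol_left (has.trans hsb) hq] at h
  exact Prod.ext h.1 h.2

/-- The flow property: by uniqueness, the solution may be restarted at `s` from the values reached
there. -/
theorem edgeSol_transport {s : ℝ} (has : a ≤ s) (hsb : s ≤ b)
    (hq : IntervalIntegrable q volume a b) (z : ℂ) (c : ℂ × ℂ) {x : ℝ} (hx : x ∈ Icc s b) :
    edgeSol a b q z c x = edgeSol s b q z (edgeSol a b q z c s) x := by
  have hq' : IntervalIntegrable q volume s b := hq.mono_set (by
    rw [uIcc_of_le hsb, uIcc_of_le (has.trans hsb)]
    exact Icc_subset_Icc_left has)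
  have h := ((isEdgeSol_edgeSol (has.trans hsb) hq z c).mono has hsb le_rfl).eq_edgeSol hsb hq' hx
  exact Prod.ext h.1 h.2

theorem continuous_edgeSol_uncurry (hab : a ≤ b) (hq : IntervalIntegrable q volume a b)
    (c : ℂ × ℂ) : Continuous fun p : ℂ × ℝ => edgeSol a b q p.1 c p.2 := by
  have h : Continuous fun p : ℂ × ℝ => (edgeSol a b q p.1 c, p.2) :=
    (((differentiable_edgeSol hab hq c).continuous).comp continuous_fst).prodMk continuous_snd
  exact continuous_eval.comp h

theorem differentiable_edgeSol_apply (hab : a ≤ b) (hq : IntervalIntegrable q volume a b)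
    (c : ℂ × ℂ) (x : ℝ) : Differentiable ℂ fun z => edgeSol a b q z c x :=
  (BoundedContinuousFunction.evalCLM ℂ x (β := ℂ × ℂ)).differentiable.comp
    (differentiable_edgeSol hab hq c)

end EdgeSol

end QuantumStar

namespace QuantumStar

/-! ### The characteristic matrix of a problem -/

namespace Problem

variable {ι : Type}

/-- All edges are nondegenerate and all potentials are integrable. -/
def IsRegular (P : Problem ι) : Prop :=
  ∀ i, P.a i < P.b i ∧ IntervalIntegrable (P.V i) volume (P.a i) (P.b i)

/-- The solution (and its derivative) on the edge `i` with the data `c` at the common vertex. -/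
noncomputable def sol (P : Problem ι) (z : ℂ) (c : ι ⊕ ι → ℂ) (i : ι) (x : ℝ) : ℂ × ℂ :=
  edgeSol (P.a i) (P.b i) (P.V i) z (c (Sum.inl i), c (Sum.inr i)) x

theorem sol_add (P : Problem ι) (z : ℂ) (c d : ι ⊕ ι → ℂ) (i : ι) (x : ℝ) :
    P.sol z (c + d) i x = P.sol z c i x + P.sol z d i x := by
  simp only [sol, Pi.add_apply, ← BoundedContinuousFunction.add_apply, ← map_add]
  rfl

theorem sol_smul (P : Problem ι) (z r : ℂ) (c : ι ⊕ ι → ℂ) (i : ι) (x : ℝ) :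
    P.sol z (r • c) i x = r • P.sol z c i x := by
  simp only [sol, Pi.smul_apply, ← BoundedContinuousFunction.smul_apply, ← map_smul]
  rfl

section

variable {P : Problem ι} (hP : P.IsRegular)

include hP

theorem IsRegular.isEdgeSol (z : ℂ) (c : ι ⊕ ι → ℂ) (i : ι) :
    IsEdgeSol (P.a i) (P.b i) (P.V i) z (fun x => (P.sol z c i x).1)
      (fun x => (P.sol z c i x).2) :=
  isEdgeSol_edgeSol (hP i).1.le (hP i).2 z _

theorem IsRegular.sol_left (z : ℂ) (c : ι ⊕ ι → ℂ) (i : ι) :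
    P.sol z c i (P.a i) = (c (Sum.inl i), c (Sum.inr i)) :=
  edgeSol_left (hP i).1.le (hP i).2 z _

end

variable [Fintype ι]

theorem trace_congr (P : Problem ι) {u u' v v' : ι → ℝ → ℂ}
    (h : ∀ i, u i (P.a i) = v i (P.a i) ∧ u' i (P.a i) = v' i (P.a i) ∧
      u i (P.b i) = v i (P.b i) ∧ u' i (P.b i) = v' i (P.b i)) : P.trace u u' = P.trace v v' := by
  have h1 : (fun i => u i (P.a i)) = fun i => v i (P.a i) := funext fun i => (h i).1
  have h2 : (fun i => u' i (P.a i)) = fun i => v' i (P.a i) := funext fun i => (h i).2.1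
  have h3 : (fun i => u i (P.b i)) = fun i => v i (P.b i) := funext fun i => (h i).2.2.1
  have h4 : (fun i => u' i (P.b i)) = fun i => v' i (P.b i) := funext fun i => (h i).2.2.2
  rw [trace, trace, h1, h2, h3, h4]

/-- The trace of the solution with data `c`. -/
noncomputable def charMap (P : Problem ι) (z : ℂ) : (ι ⊕ ι → ℂ) →ₗ[ℂ] (ι ⊕ ι → ℂ) where
  toFun c := P.trace (fun i x => (P.sol z c i x).1) (fun i x => (P.sol z c i x).2)
  map_add' c d := by
    ext x
    rcases x with x | x <;>
      simp [trace, sol_add, Matrix.mulVec, dotProduct, mul_add, Finset.sum_add_distrib] <;> ring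
  map_smul' r c := by
    ext x
    rcases x with x | x <;>
      simp [trace, sol_smul, Matrix.mulVec, dotProduct, mul_add, Finset.mul_sum, mul_left_comm]

theorem charMap_apply (P : Problem ι) (z : ℂ) (c : ι ⊕ ι → ℂ) : P.charMap z c =
    P.trace (fun i x => (P.sol z c i x).1) (fun i x => (P.sol z c i x).2) := rfl

theorem charMap_inl (P : Problem ι) (z : ℂ) (c : ι ⊕ ι → ℂ) (i : ι) :
    P.charMap z c (Sum.inl i) = (P.β₁ *ᵥ (fun i => (P.sol z c i (P.b i)).1) +
      P.β₂ *ᵥ (fun i => (P.sol z c i (P.b i)).2)) i := rfl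

/-- The rows at the common vertex involve only the data, hence do not depend on `z`; only the outer
rows carry the spectral parameter. -/
theorem IsRegular.charMap_inr {P : Problem ι} (hP : P.IsRegular) (z : ℂ) (c : ι ⊕ ι → ℂ) (i : ι) :
    P.charMap z c (Sum.inr i) =
      (P.α₁ *ᵥ (fun i => c (Sum.inl i)) + P.α₂ *ᵥ (fun i => c (Sum.inr i))) i := by
  rw [charMap_apply, trace, Sum.elim_inr]
  simp only [hP.sol_left]

section Solves

variable {P : Problem ι} (hP : P.IsRegular) {z : ℂ}

include hP

omit [Fintype ι] in
theorem IsRegular.isTwiceDiff_sol (z : ℂ) (c : ι ⊕ ι → ℂ) :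
    P.IsTwiceDiff (fun i x => (P.sol z c i x).1) (fun i x => (P.sol z c i x).2)
      (fun i x => ((P.V i x : ℂ) - z) * (P.sol z c i x).1) :=
  fun i => hP.isEdgeSol z c i

theorem IsRegular.solves_sol (z : ℂ) (c : ι ⊕ ι → ℂ) :
    P.Solves z (P.charMap z c) (fun i x => (P.sol z c i x).1) (fun i x => (P.sol z c i x).2) :=
  ⟨⟨_, hP.isTwiceDiff_sol z c, fun i => Filter.Eventually.of_forall fun x => by ring⟩, rfl⟩

omit [Fintype ι] in
theorem IsRegular.eq_sol_of_isEdgeSol {u v : ι → ℝ → ℂ}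
    (h : ∀ i, IsEdgeSol (P.a i) (P.b i) (P.V i) z (u i) (v i)) (i : ι) {x : ℝ}
    (hx : x ∈ Icc (P.a i) (P.b i)) :
    (u i x, v i x) = P.sol z (Sum.elim (fun i => u i (P.a i)) (fun i => v i (P.a i))) i x :=
  Prod.ext ((h i).eq_edgeSol (hP i).1.le (hP i).2 hx).1
    ((h i).eq_edgeSol (hP i).1.le (hP i).2 hx).2

theorem IsRegular.trace_eq_charMap {u v : ι → ℝ → ℂ}
    (h : ∀ i, IsEdgeSol (P.a i) (P.b i) (P.V i) z (u i) (v i)) :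
    P.trace u v =
      P.charMap z (Sum.elim (fun i => u i (P.a i)) (fun i => v i (P.a i))) := by
  rw [charMap_apply]
  refine trace_congr P fun i => ?_
  have ha := hP.eq_sol_of_isEdgeSol h i (left_mem_Icc.2 (hP i).1.le)
  have hb := hP.eq_sol_of_isEdgeSol h i (right_mem_Icc.2 (hP i).1.le)
  rw [← ha, ← hb]
  exact ⟨rfl, rfl, rfl, rfl⟩

omit hP in
theorem Solves.isEdgeSol (hP : P.IsRegular) {h : ι ⊕ ι → ℂ} {u v : ι → ℝ → ℂ}
    (hs : P.Solves z h u v) (i : ι) : IsEdgeSol (P.a i) (P.b i) (P.V i) z (u i) (v i) := by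
  obtain ⟨⟨w, hw, hae⟩, -⟩ := hs
  refine ⟨(hw i).1, (hw i).2.congr (hP i).1.le (fun _ _ => rfl) ?_⟩
  filter_upwards [hae i] with x hx
  linear_combination -hx

omit hP in
theorem Solves.exists_data (hP : P.IsRegular) {h : ι ⊕ ι → ℂ} {u v : ι → ℝ → ℂ}
    (hs : P.Solves z h u v) : ∃ c, P.charMap z c = h ∧
      ∀ i, ∀ x ∈ Icc (P.a i) (P.b i), (u i x, v i x) = P.sol z c i x :=
  ⟨_, (hP.trace_eq_charMap (hs.isEdgeSol hP)).symm.trans hs.2,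
    fun i _ hx => hP.eq_sol_of_isEdgeSol (hs.isEdgeSol hP) i hx⟩

theorem IsRegular.isUniqueSolution_sol (hinj : Function.Injective (P.charMap z))
    {c h : ι ⊕ ι → ℂ} (hc : P.charMap z c = h) :
    P.IsUniqueSolution z h (fun i x => (P.sol z c i x).1) (fun i x => (P.sol z c i x).2) := by
  refine ⟨hc ▸ hP.solves_sol z c, fun v v' hv i x hx => ?_⟩
  obtain ⟨d, hd, he⟩ := hv.exists_data hP
  rw [hinj (hd.trans hc.symm)] at he
  exact congrArg Prod.fst (he i x hx)

-- `IsUniqueSolution` compares functions only, whereas the Dirichlet-to-Neumann maps read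
-- derivatives. Here both are recovered from the data.
omit hP in
theorem Solves.eq_sol (hP : P.IsRegular) (hinj : Function.Injective (P.charMap z))
    {c h : ι ⊕ ι → ℂ} (hc : P.charMap z c = h) {u v : ι → ℝ → ℂ} (hs : P.Solves z h u v) (i : ι)
    {x : ℝ} (hx : x ∈ Icc (P.a i) (P.b i)) : (u i x, v i x) = P.sol z c i x := by
  obtain ⟨d, hd, he⟩ := hs.exists_data hP
  rw [hinj (hd.trans hc.symm)] at he
  exact he i x hx

end Solves

/-! ### Eigenfunctions in `L²` and the kernel of the characteristic map. -/

section Eigenspace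

variable {P : Problem ι}

omit [Fintype ι] in
theorem memLp_sol (P : Problem ι) (z : ℂ) (c : ι ⊕ ι → ℂ) (i : ι) :
    MemLp (fun x => (P.sol z c i x).1) 2 (volume.restrict (Ioc (P.a i) (P.b i))) := by
  refine MemLp.of_bound ?_ ‖edgeSol (P.a i) (P.b i) (P.V i) z (c (Sum.inl i), c (Sum.inr i))‖
    (Filter.Eventually.of_forall fun x => ?_)
  · exact (continuous_fst.comp (edgeSol (P.a i) (P.b i) (P.V i) z
      (c (Sum.inl i), c (Sum.inr i))).continuous).aestronglyMeasurable
  · exact (norm_fst_le _).trans (BoundedContinuousFunction.norm_coe_le_norm _ x)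

/-- The solution with data `c` as an element of `L²(Ω)`. -/
noncomputable def solL2 (P : Problem ι) (z : ℂ) : (ι ⊕ ι → ℂ) →ₗ[ℂ] P.L2 where
  toFun c := WithLp.toLp 2 fun i => (P.memLp_sol z c i).toLp _
  map_add' c d := by
    ext1 i
    simp only [PiLp.add_apply]
    rw [← MemLp.toLp_add]
    congr 1
    funext x
    simp [sol_add]
  map_smul' r c := by
    ext1 i
    simp only [PiLp.smul_apply, RingHom.id_apply]
    rw [← MemLp.toLp_const_smul]
    congr 1
    funext x
    simp [sol_smul]

omit [Fintype ι] in
theorem coeFn_solL2 (P : Problem ι) (z : ℂ) (c : ι ⊕ ι → ℂ) (i : ι) :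
    P.solL2 z c i =ᵐ[volume.restrict (Ioc (P.a i) (P.b i))] fun x => (P.sol z c i x).1 :=
  (P.memLp_sol z c i).coeFn_toLp

omit [Fintype ι] in
theorem IsRegular.data_eq_zero (hP : P.IsRegular) {z : ℂ} {c : ι ⊕ ι → ℂ}
    (h : ∀ i, (fun x => (P.sol z c i x).1) =ᵐ[volume.restrict (Ioc (P.a i) (P.b i))] 0) :
    c = 0 := by
  have h1 : ∀ i, P.sol z c i (P.a i) = 0 := by
    intro i
    have ha := left_mem_Icc.2 (hP i).1.le
    have hs := hP.isEdgeSol z c i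
    have h2 := isPrimitiveOn_zero hs.1 (h i)
    have h3 := isPrimitiveOn_zero hs.2 h2.2
    exact Prod.ext (h2.1 (hP i).1 _ ha) (h3.1 (hP i).1 _ ha)
  ext x
  rcases x with i | i
  · have := h1 i
    rw [hP.sol_left] at this
    exact congrArg Prod.fst this
  · have := h1 i
    rw [hP.sol_left] at this
    exact congrArg Prod.snd this

theorem IsRegular.solL2_injective (hP : P.IsRegular) (z : ℂ) :
    Function.Injective (P.solL2 z) := by
  rw [injective_iff_map_eq_zero]
  intro c hc
  refine hP.data_eq_zero (z := z) fun i => (P.coeFn_solL2 z c i).symm.trans ?_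
  rw [hc]
  exact Lp.coeFn_zero _ _ _

variable [DecidableEq ι]

/-- An eigenfunction is a class in `L²` and a kernel vector is a tuple of data; the two spaces are
compared inside `L²`, where both embed injectively. -/
theorem map_eigenspace (P : Problem ι) (hP : P.IsRegular) (z : ℂ) :
    (eigenspace P.operator z).map P.operator.domain.subtype =
      (LinearMap.ker (P.charMap z)).map (P.solL2 z) := by
  have hgraph : ∀ f : P.L2, f ∈ (eigenspace P.operator z).map P.operator.domain.subtype ↔
      (f, z • f) ∈ P.operatorGraph := by
    intro f
    rw [← operator_graph, LinearPMap.mem_graph_iff, Submodule.mem_map]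
    refine exists_congr fun y => ?_
    rw [eigenspace, LinearMap.mem_ker, LinearMap.sub_apply, sub_eq_zero]
    constructor
    · rintro ⟨h1, rfl⟩
      exact ⟨rfl, h1⟩
    · rintro ⟨rfl, h1⟩
      exact ⟨h1, rfl⟩
  ext f
  rw [hgraph, Submodule.mem_map]
  constructor
  · rintro ⟨u, v, w, hd, ht, hr⟩
    have hs : P.Solves z 0 u v := by
      refine ⟨⟨w, hd, fun i => ?_⟩, ht⟩
      filter_upwards [(hr i).1, (hr i).2, Lp.coeFn_smul z (f i)] with x h1 h2 h3
      simp only [PiLp.smul_apply, Pi.smul_apply, smul_eq_mul] at h1 h2 h3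
      rw [← h2, h3, h1]
      ring
    obtain ⟨c, hc, he⟩ := hs.exists_data hP
    refine ⟨c, hc, ?_⟩
    ext1 i
    refine Lp.ext ((P.coeFn_solL2 z c i).trans (Filter.EventuallyEq.trans ?_ (hr i).1.symm))
    rw [Filter.EventuallyEq, ae_restrict_iff' measurableSet_Ioc]
    exact Filter.Eventually.of_forall fun x hx =>
      (congrArg Prod.fst (he i x (Ioc_subset_Icc_self hx))).symm
  · rintro ⟨c, hc, rfl⟩
    refine ⟨_, _, _, hP.isTwiceDiff_sol z c, hc, fun i => ⟨P.coeFn_solL2 z c i, ?_⟩⟩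
    filter_upwards [P.coeFn_solL2 z c i, Lp.coeFn_smul z (P.solL2 z c i)] with x h1 h2
    simp only [PiLp.smul_apply, Pi.smul_apply, smul_eq_mul] at h2 ⊢
    rw [h2, h1]
    ring

/-- Eigenfunctions correspond to the kernel of the characteristic map. -/
noncomputable def eigenspaceEquiv (P : Problem ι) (hP : P.IsRegular) (z : ℂ) :
    eigenspace P.operator z ≃ₗ[ℂ] LinearMap.ker (P.charMap z) :=
  (Submodule.equivMapOfInjective _ (Submodule.injective_subtype _) _).trans
    ((LinearEquiv.ofEq _ _ (map_eigenspace P hP z)).trans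
      (Submodule.equivMapOfInjective _ (hP.solL2_injective z) _).symm)

/-- The matrix of the characteristic map. -/
noncomputable def charMatrix (P : Problem ι) (z : ℂ) : Matrix (ι ⊕ ι) (ι ⊕ ι) ℂ :=
  LinearMap.toMatrix' (P.charMap z)

/-- The characteristic determinant. -/
noncomputable def charFun (P : Problem ι) (z : ℂ) : ℂ := (P.charMatrix z).det

theorem charMatrix_mulVec (P : Problem ι) (z : ℂ) (c : ι ⊕ ι → ℂ) :
    P.charMatrix z *ᵥ c = P.charMap z c :=
  LinearMap.toMatrix'_mulVec _ _

theorem charMap_injective_iff (P : Problem ι) (z : ℂ) :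
    Function.Injective (P.charMap z) ↔ P.charFun z ≠ 0 := by
  have h : (fun c => P.charMatrix z *ᵥ c) = P.charMap z := funext (P.charMatrix_mulVec z)
  rw [← h, Matrix.mulVec_injective_iff_isUnit, Matrix.isUnit_iff_isUnit_det, isUnit_iff_ne_zero,
    charFun]

end Eigenspace

end Problem

end QuantumStar

namespace QuantumStar

/-! ### The order of vanishing of a determinant -/

/-- Along the splitting of `E` into `K` and `ker p`, the map is `w` on the first summand and the
identity on the second. -/
theorem det_smul_proj_add {E : Type*} [AddCommGroup E] [Module ℂ E] [FiniteDimensional ℂ E]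
    {K : Submodule ℂ E} {p : E →ₗ[ℂ] E} (hp : LinearMap.IsProj K p) (w : ℂ) :
    LinearMap.det (w • p + (1 - p)) = w ^ Module.finrank ℂ K := by
  have h : w • p + (1 - p) = (K.prodEquivOfIsCompl (LinearMap.ker p) hp.isCompl).conj
      (LinearMap.prodMap (w • LinearMap.id) LinearMap.id) := by
    have h1 : (1 : E →ₗ[ℂ] E) = (K.prodEquivOfIsCompl (LinearMap.ker p) hp.isCompl).conj
      (LinearMap.prodMap LinearMap.id LinearMap.id) := by
      rw [LinearMap.prodMap_id, LinearEquiv.conj_id]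
      rfl
    have h2 := hp.eq_conj_prodMap
    generalize K.prodEquivOfIsCompl (LinearMap.ker p) hp.isCompl = e at h1 h2 ⊢
    have h3 : w • p + (1 - p) = w • e.conj (LinearMap.prodMap LinearMap.id 0) +
        (e.conj (LinearMap.prodMap LinearMap.id LinearMap.id) -
          e.conj (LinearMap.prodMap LinearMap.id 0)) := by
      rw [← h1, ← h2]
    rw [h3, ← map_smul, ← map_sub, ← map_add]
    congr 1
    ext x <;> simp
  rw [h, LinearEquiv.conj_apply, LinearMap.comp_assoc, LinearMap.det_conj, LinearMap.det_prodMap,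
    LinearMap.det_smul]
  simp

theorem differentiable_det {m : Type*} [Fintype m] [DecidableEq m] {T : ℂ → Matrix m m ℂ}
    (hT : ∀ i j, Differentiable ℂ fun z => T z i j) : Differentiable ℂ fun z => (T z).det := by
  simp only [Matrix.det_apply]
  fun_prop

/-- The hypothesis `h` forbids Jordan chains of length two at `μ`. With `p` a projection onto the
kernel, `T z = S z * ((z - μ) • p + (1 - p))` for an entire `S`; `h` makes `S μ` invertible, so the
second factor alone accounts for the order. -/
theorem meromorphicOrderAt_det {m : Type*} [Fintype m] [DecidableEq m] {T : ℂ → Matrix m m ℂ}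
    (hT : ∀ i j, Differentiable ℂ fun z => T z i j) (μ : ℂ)
    (h : ∀ v w, T μ *ᵥ v = 0 →
      Matrix.of (fun i j => deriv (fun z => T z i j) μ) *ᵥ v = T μ *ᵥ w → v = 0) :
    meromorphicOrderAt (fun z => (T z).det) μ =
      (Module.finrank ℂ (LinearMap.ker (T μ).mulVecLin) : ℤ) := by
  set K := LinearMap.ker (T μ).mulVecLin with hK
  obtain ⟨g, hg⟩ := K.subtype.exists_leftInverse_of_injective K.ker_subtype
  have hp : LinearMap.IsProj K (K.subtype ∘ₗ g) :=
    ⟨fun x => (g x).2, fun x hx => congrArg Subtype.val (LinearMap.congr_fun hg ⟨x, hx⟩)⟩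
  set p : Matrix m m ℂ := LinearMap.toMatrix' (K.subtype ∘ₗ g) with hpdef
  have hpv : ∀ v, p *ᵥ v = (g v : m → ℂ) := fun v => LinearMap.toMatrix'_mulVec _ _
  have hTp : T μ * p = 0 := by
    refine Matrix.toLin'.injective (LinearMap.ext fun v => ?_)
    rw [Matrix.toLin'_mul_apply, Matrix.toLin'_apply, Matrix.toLin'_apply, hpv, map_zero]
    exact (g v).2
  have hpp : p * p = p := by
    rw [hpdef, ← LinearMap.toMatrix'_comp]
    congr 1
    exact hp.isIdempotentElem
  -- The divided difference of `T` at `μ`, with value `T' μ` at `μ`; it is entire by removability of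
  -- the singularity.
  set R : ℂ → Matrix m m ℂ := fun z => Matrix.of fun i j => dslope (fun w => T w i j) μ z with hR
  have hTR : ∀ z, T z = T μ + (z - μ) • R z := by
    intro z
    ext i j
    have := sub_smul_dslope (fun w => T w i j) μ z
    simp only [smul_eq_mul] at this
    simp [hR, this]
  set S : ℂ → Matrix m m ℂ := fun z => R z * p + T z * (1 - p) with hS
  have hTS : ∀ z, T z = S z * ((z - μ) • p + (1 - p)) := by
    intro z
    have h1 : T z * p = (z - μ) • (R z * p) := by
      conv_lhs => rw [hTR z, add_mul, hTp, zero_add, Matrix.smul_mul]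
    have h2 : p * (1 - p) = 0 := by rw [mul_sub, mul_one, hpp, sub_self]
    have h3 : (1 - p) * p = 0 := by rw [sub_mul, one_mul, hpp, sub_self]
    have h4 : (1 - p) * (1 - p) = 1 - p := by rw [mul_sub, mul_one, h3, sub_zero]
    simp only [hS, add_mul, mul_add, Matrix.mul_smul, Matrix.mul_assoc, hpp, h2, h3, h4,
      mul_zero, add_zero, smul_zero, zero_add]
    rw [← h1, ← mul_add]
    simp
  have hdetS : (S μ).det ≠ 0 := by
    intro h0
    obtain ⟨x, hx0, hx⟩ := Matrix.exists_mulVec_eq_zero_iff.2 h0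
    have h1 : R μ *ᵥ (p *ᵥ x) + T μ *ᵥ ((1 - p) *ᵥ x) = 0 := by
      rw [Matrix.mulVec_mulVec, Matrix.mulVec_mulVec, ← Matrix.add_mulVec]
      exact hx
    have h2 : p *ᵥ x = 0 := by
      -- A null vector `x` of `S μ` would give the chain formed by `p x` and `-(1 - p) x`.
      refine h _ (-((1 - p) *ᵥ x)) ?_ ?_
      · rw [Matrix.mulVec_mulVec, hTp, Matrix.zero_mulVec]
      · rw [Matrix.mulVec_neg, eq_neg_iff_add_eq_zero]
        simpa only [hR, dslope_same] using h1
    rw [h2, Matrix.mulVec_zero, zero_add, Matrix.sub_mulVec, h2, sub_zero,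
      Matrix.one_mulVec] at h1
    have h3 : p *ᵥ x = x := by
      rw [hpv]
      exact hp.map_id x h1
    exact hx0 (h3.symm.trans h2)
  have hSd : Differentiable ℂ fun z => (S z).det := by
    refine differentiable_det fun i j => ?_
    have hRd : ∀ i j, Differentiable ℂ fun z => R z i j := by
      intro i j
      have := (Complex.differentiableOn_dslope (c := μ) Filter.univ_mem).2
        (hT i j).differentiableOn
      rwa [differentiableOn_univ] at this
    simp only [hS, Matrix.add_apply, Matrix.mul_apply]
    fun_prop
  have hdet : ∀ z, (T z).det = (z - μ) ^ Module.finrank ℂ K • (S z).det := by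
    intro z
    have h1 : ((z - μ) • p + (1 - p)).det = (z - μ) ^ Module.finrank ℂ K := by
      rw [← det_smul_proj_add hp, ← LinearMap.det_toMatrix']
      congr 1
      simp [hpdef]
    conv_lhs => rw [hTS z, Matrix.det_mul, h1]
    rw [smul_eq_mul, mul_comm]
  exact (meromorphicOrderAt_eq_int_iff
    ((differentiable_det hT).analyticAt μ).meromorphicAt).2 ⟨fun z => (S z).det, hSd.analyticAt μ, hdetS,
    Filter.Eventually.of_forall fun z => by simpa using hdet z⟩

end QuantumStar

namespace QuantumStar

/-! ### Self-adjointness -/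

variable {ι : Type} [Fintype ι]

/-- The solutions `(x, y)` of `A x + B y = 0` form an isotropic subspace. -/
def IsIsotropic (A B : Matrix ι ι ℂ) : Prop :=
  ∀ x y x' y' : ι → ℂ, A *ᵥ x + B *ᵥ y = 0 → A *ᵥ x' + B *ᵥ y' = 0 →
    star x ⬝ᵥ y' = star y ⬝ᵥ x'

-- The relation `A * Bᴴ = B * Aᴴ` puts the range of `p ↦ (Bᴴ p, -Aᴴ p)` inside the solution space,
-- and full rank makes both of dimension `card ι`. In this parametrization the isotropy identity is
-- the same relation again.
open scoped ComplexOrder in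
theorem isIsotropic_of_rank {A B : Matrix ι ι ℂ}
    (hr : (Matrix.fromCols A B).rank = Fintype.card ι) (h : A * Bᴴ = B * Aᴴ) :
    IsIsotropic A B := by
  classical
  set Φ := (Matrix.fromCols A B).mulVecLin with hΦ
  set Ψ := (Matrix.fromRows Bᴴ (-Aᴴ)).mulVecLin with hΨ
  have hsurj : LinearMap.range Φ = ⊤ := by
    apply Submodule.eq_top_of_finrank_eq
    rw [Module.finrank_fintype_fun_eq_card, ← hr]
    rfl
  have hker : Module.finrank ℂ (LinearMap.ker Φ) = Fintype.card ι := by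
    have := Φ.finrank_range_add_finrank_ker
    rw [hsurj, finrank_top, Module.finrank_fintype_fun_eq_card, Module.finrank_fintype_fun_eq_card,
      Fintype.card_sum] at this
    omega
  have hΨv : ∀ p, Ψ p = Sum.elim (Bᴴ *ᵥ p) (-(Aᴴ *ᵥ p)) := fun p => by
    rw [hΨ, Matrix.mulVecLin_apply, Matrix.fromRows_mulVec, Matrix.neg_mulVec]
  have hΦv : ∀ x y, Φ (Sum.elim x y) = A *ᵥ x + B *ᵥ y := fun x y => by
    rw [hΦ, Matrix.mulVecLin_apply, Matrix.fromCols_mulVec]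
    rfl
  have hle : LinearMap.range Ψ ≤ LinearMap.ker Φ := by
    rintro _ ⟨p, rfl⟩
    rw [LinearMap.mem_ker, hΨv, hΦv, Matrix.mulVec_neg, Matrix.mulVec_mulVec,
      Matrix.mulVec_mulVec, h, add_neg_cancel]
  have hinj : Function.Injective Ψ := by
    rw [injective_iff_map_eq_zero]
    intro p hp
    rw [hΨv] at hp
    have hB : Bᴴ *ᵥ p = 0 := funext fun i => congrFun hp (Sum.inl i)
    have hA : Aᴴ *ᵥ p = 0 := funext fun i => by
      simpa using congrFun hp (Sum.inr i)
    -- A vector killed by `Aᴴ` and `Bᴴ` is orthogonal to the range of `Φ`, which is everything, so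
    -- it is orthogonal to itself.
    obtain ⟨w, hw⟩ := LinearMap.range_eq_top.1 hsurj p
    have hw' : w = Sum.elim (fun i => w (Sum.inl i)) (fun i => w (Sum.inr i)) := by
      ext x
      rcases x with x | x <;> rfl
    rw [← dotProduct_star_self_eq_zero]
    nth_rewrite 2 [← hw]
    rw [hw', hΦv, dotProduct_add, Matrix.dotProduct_mulVec, Matrix.dotProduct_mulVec,
      ← Matrix.conjTranspose_conjTranspose A, ← Matrix.star_mulVec,
      ← Matrix.conjTranspose_conjTranspose B, ← Matrix.star_mulVec, hA, hB]
    simp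
  have heq : LinearMap.range Ψ = LinearMap.ker Φ :=
    Submodule.eq_of_le_of_finrank_eq hle (by
      rw [LinearMap.finrank_range_of_inj hinj, Module.finrank_fintype_fun_eq_card, hker])
  have hparam : ∀ x y, A *ᵥ x + B *ᵥ y = 0 → ∃ p, x = Bᴴ *ᵥ p ∧ y = -(Aᴴ *ᵥ p) := by
    intro x y hxy
    have : Sum.elim x y ∈ LinearMap.range Ψ := by
      rw [heq, LinearMap.mem_ker, hΦv, hxy]
    obtain ⟨p, hp⟩ := this
    rw [hΨv] at hp
    exact ⟨p, funext fun i => (congrFun hp (Sum.inl i)).symm,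
      funext fun i => (congrFun hp (Sum.inr i)).symm⟩
  intro x y x' y' h1 h2
  obtain ⟨p, rfl, rfl⟩ := hparam x y h1
  obtain ⟨r, rfl, rfl⟩ := hparam x' y' h2
  rw [Matrix.star_mulVec, star_neg, Matrix.star_mulVec, dotProduct_neg, neg_dotProduct,
    Matrix.conjTranspose_conjTranspose, Matrix.conjTranspose_conjTranspose,
    Matrix.dotProduct_mulVec, Matrix.dotProduct_mulVec, Matrix.vecMul_vecMul,
    Matrix.vecMul_vecMul, h]

/-- Since the first factor vanishes at `μ`, continuity of `h` suffices; the integral in Green's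
formula need not be differentiated. -/
theorem hasDerivAt_sub_mul {h : ℂ → ℂ} {μ : ℂ} (hc : ContinuousAt h μ) :
    HasDerivAt (fun z => (μ - z) * h z) (-h μ) μ := by
  rw [hasDerivAt_iff_tendsto_slope]
  refine Filter.Tendsto.congr' ?_ (hc.neg.tendsto.mono_left nhdsWithin_le_nhds)
  filter_upwards [self_mem_nhdsWithin] with z hz
  have : z - μ ≠ 0 := sub_ne_zero.2 hz
  rw [slope_def_field, sub_self, zero_mul, sub_zero]
  simp only [Pi.neg_apply]
  field_simp
  ring

namespace Problem

/-- The conditions at the common vertex and at the outer vertices are isotropic. -/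
def IsSelfAdjoint (P : Problem ι) : Prop :=
  IsIsotropic P.α₁ P.α₂ ∧ IsIsotropic P.β₁ P.β₂

section

variable {P : Problem ι} (hP : P.IsRegular)

include hP

theorem IsRegular.green (z ζ : ℂ) (c d : ι ⊕ ι → ℂ) :
    (star (fun i => (P.sol ζ d i (P.b i)).1) ⬝ᵥ (fun i => (P.sol z c i (P.b i)).2) -
      star (fun i => (P.sol ζ d i (P.b i)).2) ⬝ᵥ (fun i => (P.sol z c i (P.b i)).1)) -
    (star (fun i => d (Sum.inl i)) ⬝ᵥ (fun i => c (Sum.inr i)) -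
      star (fun i => d (Sum.inr i)) ⬝ᵥ (fun i => c (Sum.inl i))) =
    (star ζ - z) * ∑ i, ∫ t in P.a i..P.b i, star (P.sol ζ d i t).1 * (P.sol z c i t).1 := by
  rw [Finset.mul_sum]
  simp only [dotProduct, ← Finset.sum_sub_distrib]
  refine Finset.sum_congr rfl fun i _ => ?_
  have h := (hP.isEdgeSol z c i).green (hP i).1.le (hP.isEdgeSol ζ d i)
  simp only [hP.sol_left] at h
  exact h

omit [Fintype ι] hP in
theorem integral_star_mul_self (P : Problem ι) (z : ℂ) (c : ι ⊕ ι → ℂ) (i : ι) :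
    ∫ t in P.a i..P.b i, star (P.sol z c i t).1 * (P.sol z c i t).1 =
      ((∫ t in P.a i..P.b i, ‖(P.sol z c i t).1‖ ^ 2 : ℝ) : ℂ) := by
  rw [← intervalIntegral.integral_ofReal]
  refine intervalIntegral.integral_congr fun t _ => ?_
  simp only [Complex.star_def, Complex.conj_mul']
  push_cast
  rfl

theorem IsRegular.data_eq_zero_of_sum_integral_le {z : ℂ} {c : ι ⊕ ι → ℂ}
    (h : ∑ i, ∫ t in P.a i..P.b i, ‖(P.sol z c i t).1‖ ^ 2 ≤ 0) : c = 0 := by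
  have hnn : ∀ i, 0 ≤ ∫ t in P.a i..P.b i, ‖(P.sol z c i t).1‖ ^ 2 := fun i =>
    intervalIntegral.integral_nonneg (hP i).1.le fun t _ => by positivity
  have h0 := (Finset.sum_eq_zero_iff_of_nonneg fun i _ => hnn i).1
    (le_antisymm h (Finset.sum_nonneg fun i _ => hnn i))
  refine hP.data_eq_zero (z := z) fun i => ?_
  have h1 := h0 i (Finset.mem_univ i)
  have hi : IntervalIntegrable (fun t => ‖(P.sol z c i t).1‖ ^ 2) volume (P.a i) (P.b i) :=
    Continuous.intervalIntegrable (((continuous_fst.comp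
      (edgeSol (P.a i) (P.b i) (P.V i) z _).continuous).norm).pow 2) _ _
  rw [intervalIntegral.integral_eq_zero_iff_of_le_of_nonneg_ae (hP i).1.le
    (Filter.Eventually.of_forall fun t => by positivity) hi] at h1
  filter_upwards [h1] with t ht
  simpa using ht

theorem IsRegular.bform_eq_zero (hS : P.IsSelfAdjoint) {z : ℂ} {c : ι ⊕ ι → ℂ}
    (hc : P.charMap z c = 0) :
    (star (fun i => (P.sol z c i (P.b i)).1) ⬝ᵥ (fun i => (P.sol z c i (P.b i)).2) -
      star (fun i => (P.sol z c i (P.b i)).2) ⬝ᵥ (fun i => (P.sol z c i (P.b i)).1)) = 0 ∧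
    (star (fun i => c (Sum.inl i)) ⬝ᵥ (fun i => c (Sum.inr i)) -
      star (fun i => c (Sum.inr i)) ⬝ᵥ (fun i => c (Sum.inl i))) = 0 := by
  have hβ := funext fun i => (P.charMap_inl z c i).symm.trans (congrFun hc (Sum.inl i))
  have hα := funext fun i => (hP.charMap_inr z c i).symm.trans (congrFun hc (Sum.inr i))
  exact ⟨sub_eq_zero.2 (hS.2 _ _ _ _ hβ hβ), sub_eq_zero.2 (hS.1 _ _ _ _ hα hα)⟩

/-- In Green's formula for a solution paired with itself, isotropy kills the boundary terms and
leaves `(star z - z)` times the squared `L²` norm. -/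
theorem IsRegular.charMap_injective_of_im_ne_zero (hS : P.IsSelfAdjoint) {z : ℂ}
    (hz : z.im ≠ 0) : Function.Injective (P.charMap z) := by
  rw [injective_iff_map_eq_zero]
  intro c hc
  have h := hP.green z z c c
  rw [(hP.bform_eq_zero hS hc).1, (hP.bform_eq_zero hS hc).2, sub_zero, eq_comm,
    mul_eq_zero] at h
  have h1 : star z - z ≠ 0 := by
    intro h0
    have := congrArg Complex.im h0
    simp at this
    exact hz (by linarith)
  have h2 := h.resolve_left h1
  simp only [integral_star_mul_self] at h2
  exact hP.data_eq_zero_of_sum_integral_le (z := z) (le_of_eq (by exact_mod_cast h2))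

omit [Fintype ι] in
theorem IsRegular.differentiable_sol (c : ι ⊕ ι → ℂ) (i : ι) (x : ℝ) :
    Differentiable ℂ fun z => P.sol z c i x :=
  differentiable_edgeSol_apply (hP i).1.le (hP i).2 _ x

omit [Fintype ι] in
theorem IsRegular.differentiable_sol_fst (c : ι ⊕ ι → ℂ) (i : ι) (x : ℝ) :
    Differentiable ℂ fun z => (P.sol z c i x).1 :=
  (hP.differentiable_sol c i x).fst

omit [Fintype ι] in
theorem IsRegular.differentiable_sol_snd (c : ι ⊕ ι → ℂ) (i : ι) (x : ℝ) :
    Differentiable ℂ fun z => (P.sol z c i x).2 :=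
  (hP.differentiable_sol c i x).snd

omit [Fintype ι] hP in
theorem continuous_sol (P : Problem ι) (z : ℂ) (c : ι ⊕ ι → ℂ) (i : ι) :
    Continuous (P.sol z c i) :=
  (edgeSol (P.a i) (P.b i) (P.V i) z (c (Sum.inl i), c (Sum.inr i))).continuous

omit [Fintype ι] in
theorem IsRegular.continuous_integral (ζ : ℂ) (c : ι ⊕ ι → ℂ) (i : ι) : Continuous fun z : ℂ =>
    ∫ t in P.a i..P.b i, star (P.sol ζ c i t).1 * (P.sol z c i t).1 := by
  have h1 : Continuous fun p : ℂ × ℝ => P.sol p.1 c i p.2 := by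
    unfold sol
    exact continuous_edgeSol_uncurry (hP i).1.le (hP i).2 (c (Sum.inl i), c (Sum.inr i))
  have h2 : Continuous fun p : ℂ × ℝ => P.sol ζ c i p.2 :=
    (P.continuous_sol ζ c i).comp continuous_snd
  let f : ℂ → ℝ → ℂ := fun z t => star (P.sol ζ c i t).1 * (P.sol z c i t).1
  have h3 : Continuous (Function.uncurry f) := by
    have h4 : Function.uncurry f =
        fun p : ℂ × ℝ => star (P.sol ζ c i p.2).1 * (P.sol p.1 c i p.2).1 := by
      funext p
      rfl
    rw [h4]
    exact h2.fst.star.mul h1.fst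
  have h5 : Continuous fun z => ∫ t in P.a i..P.b i, f z t :=
    intervalIntegral.continuous_parametric_intervalIntegral_of_continuous' h3 _ _
  exact h5

theorem IsRegular.hasDerivAt_charMap_inl (μ : ℂ) (c : ι ⊕ ι → ℂ) (i : ι) :
    HasDerivAt (fun z => P.charMap z c (Sum.inl i))
      ((P.β₁ *ᵥ (fun i => deriv (fun z => (P.sol z c i (P.b i)).1) μ) +
        P.β₂ *ᵥ (fun i => deriv (fun z => (P.sol z c i (P.b i)).2) μ)) i) μ := by
  simp only [charMap_inl, Pi.add_apply, Matrix.mulVec, dotProduct]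
  exact (HasDerivAt.fun_sum fun k _ =>
      ((hP.differentiable_sol_fst c k (P.b k)) μ).hasDerivAt.const_mul _).add
    (HasDerivAt.fun_sum fun k _ =>
      ((hP.differentiable_sol_snd c k (P.b k)) μ).hasDerivAt.const_mul _)

theorem IsRegular.hasDerivAt_charMap_inr (μ : ℂ) (c : ι ⊕ ι → ℂ) (i : ι) :
    HasDerivAt (fun z => P.charMap z c (Sum.inr i)) 0 μ := by
  simp only [hP.charMap_inr]
  exact hasDerivAt_const _ _

theorem IsRegular.differentiable_charMap (c : ι ⊕ ι → ℂ) (r : ι ⊕ ι) :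
    Differentiable ℂ fun z => P.charMap z c r := fun z => by
  rcases r with i | i
  · exact (hP.hasDerivAt_charMap_inl z c i).differentiableAt
  · exact (hP.hasDerivAt_charMap_inr z c i).differentiableAt

/-- Let `u` be the eigenfunction with data `c`. Differentiating Green's formula between `u` and the
solution with data `c` at parameter `z` shows that minus the squared norm of `u` is the outer
boundary form of `u` with `∂u/∂z`. A vector `w` with `T' c = T w` makes that form zero, so `u = 0`.
-/
theorem IsRegular.transversal (hS : P.IsSelfAdjoint) (μ : ℝ) {c w : ι ⊕ ι → ℂ}
    (hc : P.charMap μ c = 0)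
    (hw : ∀ r, deriv (fun z => P.charMap z c r) (μ : ℂ) = P.charMap μ w r) : c = 0 := by
  set D : ι → ℂ := fun i => deriv (fun z => (P.sol z c i (P.b i)).1) (μ : ℂ) with hD
  set D' : ι → ℂ := fun i => deriv (fun z => (P.sol z c i (P.b i)).2) (μ : ℂ) with hD'
  set v : ι → ℂ := fun i => (P.sol μ c i (P.b i)).1 with hv
  set v' : ι → ℂ := fun i => (P.sol μ c i (P.b i)).2 with hv'
  set y : ι → ℂ := fun i => (P.sol μ w i (P.b i)).1 with hy
  set y' : ι → ℂ := fun i => (P.sol μ w i (P.b i)).2 with hy'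
  have hβ : P.β₁ *ᵥ v + P.β₂ *ᵥ v' = 0 :=
    funext fun i => (P.charMap_inl μ c i).symm.trans (congrFun hc (Sum.inl i))
  have hα : P.α₁ *ᵥ (fun i => c (Sum.inl i)) + P.α₂ *ᵥ (fun i => c (Sum.inr i)) = 0 :=
    funext fun i => (hP.charMap_inr μ c i).symm.trans (congrFun hc (Sum.inr i))
  have hαw : P.α₁ *ᵥ (fun i => w (Sum.inl i)) + P.α₂ *ᵥ (fun i => w (Sum.inr i)) = 0 :=
    funext fun i => (hP.charMap_inr μ w i).symm.trans
      ((hw (Sum.inr i)).symm.trans (hP.hasDerivAt_charMap_inr μ c i).deriv)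
  have hβw : P.β₁ *ᵥ D + P.β₂ *ᵥ D' = P.β₁ *ᵥ y + P.β₂ *ᵥ y' :=
    funext fun i => (hP.hasDerivAt_charMap_inl μ c i).deriv.symm.trans
      ((hw (Sum.inl i)).trans (P.charMap_inl μ w i))
  -- Neither `D` nor `y` need satisfy the outer conditions, but their difference does. Isotropy thus
  -- replaces `D` by `y`, and Green's formula at `μ` moves the form to the common vertex, where `w`
  -- satisfies the conditions.
  have hβy : P.β₁ *ᵥ (D - y) + P.β₂ *ᵥ (D' - y') = 0 := by
    rw [Matrix.mulVec_sub, Matrix.mulVec_sub, sub_add_sub_comm, hβw, sub_self]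
  have e1 := hS.2 _ _ _ _ hβ hβy
  have e2 := hS.1 _ _ _ _ hα hαw
  have e3 := hP.green μ μ w c
  have hreal : star (μ : ℂ) = μ := Complex.conj_ofReal μ
  rw [hreal, sub_self, zero_mul, e2, sub_self, sub_zero] at e3
  have e4 : star v ⬝ᵥ D' - star v' ⬝ᵥ D = 0 := by
    rw [dotProduct_sub, dotProduct_sub] at e1
    linear_combination e1 + e3
  have hderiv : HasDerivAt (fun z => (star v ⬝ᵥ (fun i => (P.sol z c i (P.b i)).2) -
      star v' ⬝ᵥ (fun i => (P.sol z c i (P.b i)).1)) -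
      (star (fun i => c (Sum.inl i)) ⬝ᵥ (fun i => c (Sum.inr i)) -
      star (fun i => c (Sum.inr i)) ⬝ᵥ (fun i => c (Sum.inl i))))
      (star v ⬝ᵥ D' - star v' ⬝ᵥ D) (μ : ℂ) := by
    simp only [dotProduct]
    exact ((HasDerivAt.fun_sum fun k _ =>
        ((hP.differentiable_sol_snd c k (P.b k)) μ).hasDerivAt.const_mul _).sub
      (HasDerivAt.fun_sum fun k _ =>
        ((hP.differentiable_sol_fst c k (P.b k)) μ).hasDerivAt.const_mul _)).sub_const _
  have hcont := continuous_finsetSum Finset.univ fun i _ => hP.continuous_integral μ c i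
  have hderiv' := hasDerivAt_sub_mul hcont.continuousAt (μ := (μ : ℂ))
  have heq : ∀ z : ℂ, _ = _ := fun z => hP.green z μ c c
  simp only [hreal] at heq
  rw [← funext heq] at hderiv'
  have e5 := hderiv'.unique hderiv
  rw [e4, neg_eq_zero] at e5
  simp only [integral_star_mul_self] at e5
  exact hP.data_eq_zero_of_sum_integral_le (z := μ) (le_of_eq (by exact_mod_cast e5))

variable [DecidableEq ι]

omit hP in
theorem charMatrix_apply (P : Problem ι) (z : ℂ) (r s : ι ⊕ ι) :
    P.charMatrix z r s = P.charMap z (Pi.single s 1) r := by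
  rw [charMatrix, LinearMap.toMatrix'_apply]

theorem IsRegular.differentiable_charMatrix (r s : ι ⊕ ι) :
    Differentiable ℂ fun z => P.charMatrix z r s := by
  simp only [charMatrix_apply]
  exact hP.differentiable_charMap _ _

theorem IsRegular.differentiable_charFun : Differentiable ℂ P.charFun :=
  differentiable_det hP.differentiable_charMatrix

theorem IsRegular.meromorphicOrderAt_charFun (hS : P.IsSelfAdjoint) (μ : ℝ) :
    meromorphicOrderAt P.charFun (μ : ℂ) =
      (Module.finrank ℂ (eigenspace P.operator (μ : ℂ)) : ℤ) := by
  rw [(P.eigenspaceEquiv hP μ).finrank_eq]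
  have h := meromorphicOrderAt_det hP.differentiable_charMatrix (μ : ℂ) fun c w hc hw => by
    rw [charMatrix_mulVec] at hc
    refine hP.transversal hS μ (w := w) hc fun r => ?_
    rw [← charMatrix_mulVec, ← hw]
    have h1 : (fun z => P.charMap z c r) = fun z => ∑ s, P.charMatrix z r s * c s := by
      funext z
      rw [← charMatrix_mulVec]
      rfl
    rw [h1]
    exact (HasDerivAt.fun_sum fun s _ =>
      ((hP.differentiable_charMatrix r s) _).hasDerivAt.mul_const _).deriv
  have hm : (P.charMatrix μ).mulVecLin = P.charMap μ :=
    LinearMap.ext fun c => P.charMatrix_mulVec μ c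
  rw [hm] at h
  exact h

end

end Problem

end QuantumStar

namespace QuantumStar

/-! ### Semiboundedness -/

/-- By isotropy the pairing depends on `x` alone, so `y` may be replaced by a linear, hence bounded,
choice `y₀` of partner for `x`. -/
theorem IsIsotropic.exists_bound {ι : Type} [Fintype ι] {A B : Matrix ι ι ℂ}
    (h : IsIsotropic A B) : ∃ C : ℝ, 0 ≤ C ∧ ∀ x y : ι → ℂ, A *ᵥ x + B *ᵥ y = 0 →
      ‖star x ⬝ᵥ y‖ ≤ C * ∑ i, ‖x i‖ ^ 2 := by
  set L := LinearMap.ker (A.mulVecLin.coprod B.mulVecLin) with hL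
  have hmem : ∀ x y, (x, y) ∈ L ↔ A *ᵥ x + B *ᵥ y = 0 := fun x y => by
    rw [hL, LinearMap.mem_ker, LinearMap.coprod_apply, Matrix.mulVecLin_apply,
      Matrix.mulVecLin_apply]
  set p := (LinearMap.fst ℂ (ι → ℂ) (ι → ℂ) ∘ₗ L.subtype) with hp
  obtain ⟨σ, hσ⟩ := p.rangeRestrict.exists_rightInverse_of_surjective p.range_rangeRestrict
  set T := LinearMap.toContinuousLinearMap (LinearMap.snd ℂ (ι → ℂ) (ι → ℂ) ∘ₗ L.subtype ∘ₗ σ)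
    with hT
  refine ⟨‖T‖ * Fintype.card ι, by positivity, fun x y hxy => ?_⟩
  have hx : x ∈ LinearMap.range p := ⟨⟨(x, y), (hmem x y).2 hxy⟩, rfl⟩
  have hσx : ((σ ⟨x, hx⟩ : L) : (ι → ℂ) × (ι → ℂ)).1 = x :=
    congrArg Subtype.val (LinearMap.congr_fun hσ ⟨x, hx⟩)
  set y₀ := ((σ ⟨x, hx⟩ : L) : (ι → ℂ) × (ι → ℂ)).2 with hy₀
  have hxy₀ : A *ᵥ x + B *ᵥ y₀ = 0 := by
    have := (σ ⟨x, hx⟩).2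
    rw [← hmem]
    convert this using 1
    exact Prod.ext hσx.symm rfl
  -- The pair `(0, y - y₀)` also solves the conditions; isotropy against it makes `y - y₀`
  -- orthogonal to `x`.
  have h1 : star x ⬝ᵥ y = star x ⬝ᵥ y₀ := by
    have h2 : A *ᵥ (0 : ι → ℂ) + B *ᵥ (y - y₀) = 0 := by
      rw [Matrix.mulVec_zero, zero_add, Matrix.mulVec_sub]
      linear_combination hxy - hxy₀
    have h3 := h x y 0 (y - y₀) hxy h2
    rw [dotProduct_sub, dotProduct_zero, sub_eq_zero] at h3
    exact h3
  have h4 : ‖y₀‖ ≤ ‖T‖ * ‖x‖ := T.le_opNorm ⟨x, hx⟩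
  have hsum : ∀ i, ‖x i‖ ^ 2 ≤ ∑ k, ‖x k‖ ^ 2 := fun i =>
    Finset.single_le_sum (f := fun k => ‖x k‖ ^ 2) (fun k _ => by positivity) (Finset.mem_univ i)
  have h5 : ‖x‖ ^ 2 ≤ ∑ i, ‖x i‖ ^ 2 := by
    have h0 : 0 ≤ ∑ i, ‖x i‖ ^ 2 := Finset.sum_nonneg fun i _ => by positivity
    rw [← Real.le_sqrt (norm_nonneg _) h0]
    exact (pi_norm_le_iff_of_nonneg (Real.sqrt_nonneg _)).2 fun i =>
      (Real.le_sqrt (norm_nonneg _) h0).2 (hsum i)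
  rw [h1]
  calc ‖star x ⬝ᵥ y₀‖ ≤ ∑ i, ‖star x i * y₀ i‖ := norm_sum_le _ _
    _ ≤ ∑ _i : ι, ‖T‖ * ‖x‖ ^ 2 := by
        refine Finset.sum_le_sum fun i _ => ?_
        rw [norm_mul, Pi.star_apply, norm_star]
        calc ‖x i‖ * ‖y₀ i‖ ≤ ‖x‖ * (‖T‖ * ‖x‖) :=
              mul_le_mul (norm_le_pi_norm x i) ((norm_le_pi_norm y₀ i).trans h4)
                (norm_nonneg _) (norm_nonneg _)
          _ = ‖T‖ * ‖x‖ ^ 2 := by ring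
    _ = ‖T‖ * Fintype.card ι * ‖x‖ ^ 2 := by
        rw [Finset.sum_const, Finset.card_univ, nsmul_eq_mul]
        ring
    _ ≤ _ := by gcongr

theorem IsPrimitiveOn.norm_sub_le {a b : ℝ} {F f : ℝ → ℂ} (hF : IsPrimitiveOn a b F f) {x y : ℝ}
    (hx : x ∈ Icc a b) (hy : y ∈ Icc a b) : ‖F x - F y‖ ≤ ∫ t in a..b, ‖f t‖ := by
  have hab : a ≤ b := hx.1.trans hx.2
  wlog hxy : y ≤ x generalizing x y
  · rw [norm_sub_rev]
    exact this hy hx (le_of_not_ge hxy)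
  have h := (hF.mono hy.1 hxy hx.2).integral_eq hxy
  rw [← h]
  refine (intervalIntegral.norm_integral_le_integral_norm hxy).trans ?_
  exact intervalIntegral.integral_mono_interval hy.1 hxy hx.2
    (Filter.Eventually.of_forall fun t => norm_nonneg _) hF.1.norm

/-- The oscillation of `‖u‖ ^ 2` is at most the integral of `2 ‖u‖ ‖v‖`, which Young's inequality
splits with weight `ε`; averaging over the second point gives the term `1 / (b - a)`. -/
theorem IsPrimitiveOn.norm_sq_le {a b : ℝ} (hab : a < b) {u v : ℝ → ℂ}
    (hu : IsPrimitiveOn a b u v) (hv : ContinuousOn v (Icc a b)) {ε : ℝ} (hε : 0 < ε) {x : ℝ}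
    (hx : x ∈ Icc a b) : ‖u x‖ ^ 2 ≤ ε * (∫ t in a..b, ‖v t‖ ^ 2) +
      (1 / ε + 1 / (b - a)) * ∫ t in a..b, ‖u t‖ ^ 2 := by
  have hU := hu.continuousOn hab.le
  have hIu : IntervalIntegrable (fun t => ‖u t‖ ^ 2) volume a b := by
    refine ContinuousOn.intervalIntegrable ?_
    rw [uIcc_of_le hab.le]
    exact hU.norm.pow 2
  have hIv : IntervalIntegrable (fun t => ‖v t‖ ^ 2) volume a b := by
    refine ContinuousOn.intervalIntegrable ?_
    rw [uIcc_of_le hab.le]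
    exact hv.norm.pow 2
  have hW := hu.conj.mul hab.le hu
  have hsq : ∀ t, star (u t) * u t = ((‖u t‖ ^ 2 : ℝ) : ℂ) := fun t => by
    rw [Complex.star_def, Complex.conj_mul']
    push_cast
    rfl
  set M := ε * (∫ t in a..b, ‖v t‖ ^ 2) + 1 / ε * ∫ t in a..b, ‖u t‖ ^ 2 with hM
  have hw : ∫ t in a..b, ‖star (v t) * u t + star (u t) * v t‖ ≤ M := by
    rw [hM, ← intervalIntegral.integral_const_mul, ← intervalIntegral.integral_const_mul,
      ← intervalIntegral.integral_add (hIv.const_mul ε) (hIu.const_mul (1 / ε))]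
    refine intervalIntegral.integral_mono_on hab.le hW.1.norm
      ((hIv.const_mul ε).add (hIu.const_mul (1 / ε))) fun t _ => ?_
    have h1 : ‖star (v t) * u t + star (u t) * v t‖ ≤ 2 * (‖u t‖ * ‖v t‖) := by
      refine (norm_add_le _ _).trans (le_of_eq ?_)
      rw [norm_mul, norm_mul, norm_star, norm_star]
      ring
    have h2 : 2 * (‖u t‖ * ‖v t‖) ≤ ε * ‖v t‖ ^ 2 + 1 / ε * ‖u t‖ ^ 2 := by
      have h3 : ε * ‖v t‖ ^ 2 + 1 / ε * ‖u t‖ ^ 2 - 2 * (‖u t‖ * ‖v t‖) =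
          (ε * ‖v t‖ - ‖u t‖) ^ 2 / ε := by
        field_simp
        ring
      have h4 : 0 ≤ (ε * ‖v t‖ - ‖u t‖) ^ 2 / ε := by positivity
      linarith
    exact h1.trans h2
  have hpt : ∀ y ∈ Icc a b, ‖u x‖ ^ 2 ≤ M + ‖u y‖ ^ 2 := by
    intro y hy
    have h1 := (hW.norm_sub_le hx hy).trans hw
    rw [hsq, hsq, ← Complex.ofReal_sub, Complex.norm_real] at h1
    linarith [Real.le_norm_self (‖u x‖ ^ 2 - ‖u y‖ ^ 2)]
  have hint := intervalIntegral.integral_mono_on hab.le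
    (intervalIntegrable_const (c := ‖u x‖ ^ 2)) ((intervalIntegrable_const (c := M)).add hIu) hpt
  rw [intervalIntegral.integral_const, intervalIntegral.integral_add intervalIntegrable_const hIu,
    intervalIntegral.integral_const, smul_eq_mul, smul_eq_mul] at hint
  have hba : 0 < b - a := sub_pos.2 hab
  have h5 : ‖u x‖ ^ 2 ≤ M + (∫ t in a..b, ‖u t‖ ^ 2) / (b - a) := by
    rw [← sub_le_iff_le_add', le_div_iff₀ hba]
    linarith
  refine h5.trans (le_of_eq ?_)
  rw [hM]
  ring

namespace Problem

variable {ι : Type} [Fintype ι] {P : Problem ι}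

omit [Fintype ι] in
theorem IsRegular.energy (hP : P.IsRegular) (μ : ℝ) (c : ι ⊕ ι → ℂ) (i : ι) :
    star (P.sol μ c i (P.b i)).1 * (P.sol μ c i (P.b i)).2 -
      star (P.sol μ c i (P.a i)).1 * (P.sol μ c i (P.a i)).2 =
    (((∫ t in P.a i..P.b i, ‖(P.sol μ c i t).2‖ ^ 2) +
      (∫ t in P.a i..P.b i, P.V i t * ‖(P.sol μ c i t).1‖ ^ 2) -
      μ * ∫ t in P.a i..P.b i, ‖(P.sol μ c i t).1‖ ^ 2 : ℝ) : ℂ) := by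
  have hs := P.continuous_sol μ c i
  have h1 : IntervalIntegrable (fun t => ‖(P.sol μ c i t).1‖ ^ 2) volume (P.a i) (P.b i) :=
    (hs.fst.norm.pow 2).intervalIntegrable _ _
  have h2 : IntervalIntegrable (fun t => ‖(P.sol μ c i t).2‖ ^ 2) volume (P.a i) (P.b i) :=
    (hs.snd.norm.pow 2).intervalIntegrable _ _
  have h3 : IntervalIntegrable (fun t => P.V i t * ‖(P.sol μ c i t).1‖ ^ 2) volume
      (P.a i) (P.b i) := (hP i).2.mul_continuousOn (hs.fst.norm.pow 2).continuousOn
  rw [(hP.isEdgeSol μ c i).energy (hP i).1.le, ← intervalIntegral.integral_const_mul,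
    ← intervalIntegral.integral_add h2 h3,
    ← intervalIntegral.integral_sub (h2.add h3) (h1.const_mul μ),
    ← intervalIntegral.integral_ofReal]
  refine intervalIntegral.integral_congr fun t _ => ?_
  have e1 := Complex.conj_mul' (P.sol μ c i t).1
  have e2 := Complex.conj_mul' (P.sol μ c i t).2
  simp only [Complex.star_def]
  push_cast
  linear_combination e2 + ((P.V i t : ℂ) - μ) * e1

/-- In the energy identity the potential and boundary terms are bounded by suprema of `‖u‖ ^ 2`.
These cost an arbitrarily small part of the derivative energy plus a multiple of the squared norm,
which is impossible for a nonzero `u` once `μ` is very negative. -/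
theorem IsRegular.exists_lower_bound (hP : P.IsRegular) (hS : P.IsSelfAdjoint) :
    ∃ C : ℝ, ∀ μ : ℝ, μ < C → Function.Injective (P.charMap μ) := by
  obtain ⟨C₁, hC₁, hα⟩ := hS.1.exists_bound
  obtain ⟨C₂, hC₂, hβ⟩ := hS.2.exists_bound
  set w : ι → ℝ := fun i => ∫ t in P.a i..P.b i, ‖P.V i t‖ with hw
  have hw0 : ∀ i, 0 ≤ w i := fun i =>
    intervalIntegral.integral_nonneg (hP i).1.le fun t _ => norm_nonneg _
  have hba : ∀ i, 0 < 1 / (P.b i - P.a i) := fun i => one_div_pos.2 (sub_pos.2 (hP i).1)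
  -- `W` collects every coefficient of a supremum. With `ε = 1 / (W + 1)` the derivative energy is
  -- absorbed, as `W * ε ≤ 1`, and `κ` dominates `1 / ε + 1 / (b i - a i)` on every edge.
  set W := (∑ i, w i) + C₁ + C₂ with hW
  have hW0 : 0 ≤ W := add_nonneg (add_nonneg (Finset.sum_nonneg fun i _ => hw0 i) hC₁) hC₂
  set κ := (W + 1) + ∑ i, 1 / (P.b i - P.a i) with hκ
  refine ⟨-(W * κ), fun μ hμ => ?_⟩
  rw [injective_iff_map_eq_zero]
  intro c hc
  set D : ι → ℝ := fun i => ∫ t in P.a i..P.b i, ‖(P.sol μ c i t).2‖ ^ 2 with hD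
  set X : ι → ℝ := fun i => ∫ t in P.a i..P.b i, ‖(P.sol μ c i t).1‖ ^ 2 with hX
  set Q : ι → ℝ := fun i => ∫ t in P.a i..P.b i, P.V i t * ‖(P.sol μ c i t).1‖ ^ 2 with hQ
  have hD0 : ∀ i, 0 ≤ D i := fun i =>
    intervalIntegral.integral_nonneg (hP i).1.le fun t _ => by positivity
  have hX0 : ∀ i, 0 ≤ X i := fun i =>
    intervalIntegral.integral_nonneg (hP i).1.le fun t _ => by positivity
  set M : ι → ℝ := fun i => 1 / (W + 1) * D i + κ * X i with hMdef
  have hsup : ∀ i, ∀ x ∈ Icc (P.a i) (P.b i), ‖(P.sol μ c i x).1‖ ^ 2 ≤ M i := by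
    intro i x hx
    have h := (hP.isEdgeSol μ c i).1.norm_sq_le (hP i).1
      (P.continuous_sol μ c i).snd.continuousOn (ε := 1 / (W + 1)) (by positivity) hx
    refine h.trans (add_le_add le_rfl (mul_le_mul_of_nonneg_right ?_ (hX0 i)))
    rw [one_div_one_div, hκ]
    have := Finset.single_le_sum (f := fun i => 1 / (P.b i - P.a i)) (fun k _ => (hba k).le)
      (Finset.mem_univ i)
    exact add_le_add le_rfl this
  have hM0 : ∀ i, 0 ≤ M i := fun i =>
    le_trans (by positivity) (hsup i _ (left_mem_Icc.2 (hP i).1.le))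
  have hQM : ∀ i, -(w i * M i) ≤ Q i := by
    intro i
    rw [hw, hQ, ← intervalIntegral.integral_mul_const, ← intervalIntegral.integral_neg]
    refine intervalIntegral.integral_mono_on (hP i).1.le ((hP i).2.norm.mul_const _).neg
      ((hP i).2.mul_continuousOn ((P.continuous_sol μ c i).fst.norm.pow 2).continuousOn)
      fun t ht => ?_
    have h1 := mul_le_mul_of_nonneg_left (hsup i t ht) (norm_nonneg (P.V i t))
    have h2 := mul_le_mul_of_nonneg_right (neg_abs_le (P.V i t))
      (sq_nonneg ‖(P.sol μ c i t).1‖)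
    rw [Real.norm_eq_abs] at h1 ⊢
    linarith
  have hbdry : ∑ i, (D i + Q i - μ * X i) ≤ (C₁ + C₂) * ∑ i, M i := by
    have hβ0 := hβ _ _ (funext fun i => (P.charMap_inl μ c i).symm.trans
      (congrFun hc (Sum.inl i)))
    have hα0 := hα _ _ (funext fun i => (hP.charMap_inr μ c i).symm.trans
      (congrFun hc (Sum.inr i)))
    have hsum : ((∑ i, (D i + Q i - μ * X i) : ℝ) : ℂ) =
        star (fun i => (P.sol μ c i (P.b i)).1) ⬝ᵥ (fun i => (P.sol μ c i (P.b i)).2) -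
        star (fun i => c (Sum.inl i)) ⬝ᵥ (fun i => c (Sum.inr i)) := by
      rw [Complex.ofReal_sum]
      simp only [dotProduct, ← Finset.sum_sub_distrib]
      refine Finset.sum_congr rfl fun i _ => ?_
      have h := hP.energy μ c i
      rw [hP.sol_left] at h
      exact h.symm
    have h1 := norm_sub_le
      (star (fun i => (P.sol μ c i (P.b i)).1) ⬝ᵥ (fun i => (P.sol μ c i (P.b i)).2))
      (star (fun i => c (Sum.inl i)) ⬝ᵥ (fun i => c (Sum.inr i)))
    rw [← hsum, Complex.norm_real] at h1
    have h2 : ∑ i, ‖(P.sol μ c i (P.b i)).1‖ ^ 2 ≤ ∑ i, M i :=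
      Finset.sum_le_sum fun i _ => hsup i _ (right_mem_Icc.2 (hP i).1.le)
    have h3 : ∑ i, ‖c (Sum.inl i)‖ ^ 2 ≤ ∑ i, M i := by
      refine Finset.sum_le_sum fun i _ => ?_
      have := hsup i _ (left_mem_Icc.2 (hP i).1.le)
      rwa [hP.sol_left] at this
    have h4 := mul_le_mul_of_nonneg_left h2 hC₂
    have h5 := mul_le_mul_of_nonneg_left h3 hC₁
    linarith [Real.le_norm_self (∑ i, (D i + Q i - μ * X i))]
  have hmain : ∑ i, (-(W * κ) - μ) * X i ≤ 0 := by
    have h1 : ∑ i, ((-(W * κ) - μ) * X i) ≤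
        ∑ i, ((D i + Q i - μ * X i) - (C₁ + C₂) * M i) := by
      refine Finset.sum_le_sum fun i _ => ?_
      have h2 : w i * M i ≤ (∑ i, w i) * M i := mul_le_mul_of_nonneg_right
        (Finset.single_le_sum (fun k _ => hw0 k) (Finset.mem_univ i)) (hM0 i)
      have h3 : W * M i ≤ D i + W * κ * X i := by
        have h4 : W * (1 / (W + 1)) ≤ 1 := by
          rw [mul_one_div, div_le_one (by positivity)]
          linarith
        have h5 := mul_le_mul_of_nonneg_right h4 (hD0 i)
        simp only [hMdef]
        nlinarith
      have h6 : W * M i = (∑ i, w i) * M i + (C₁ + C₂) * M i := by rw [hW]; ring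
      linarith [hQM i]
    rw [Finset.sum_sub_distrib] at h1
    linarith [Finset.mul_sum Finset.univ M (C₁ + C₂)]
  rw [← Finset.mul_sum] at hmain
  exact hP.data_eq_zero_of_sum_integral_le (z := μ)
    (nonpos_of_mul_nonpos_right hmain (by linarith))

end Problem

end QuantumStar

namespace QuantumStar

/-! ### Cutting an edge -/

/-- The determinant of a matrix that differs from an invertible one in the rows `r a` only. -/
theorem det_eq_det_mul_of_rows {m κ : Type*} [Fintype m] [DecidableEq m] [Fintype κ]
    [DecidableEq κ] {T S : Matrix m m ℂ} (hS : S.det ≠ 0) {r : κ → m}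
    (hr : Function.Injective r) (hTS : ∀ i, i ∉ Set.range r → T i = S i) {X : κ → m → ℂ}
    (hX : ∀ a, S *ᵥ X a = Pi.single (r a) 1) :
    T.det = S.det * (Matrix.of fun a b => (T *ᵥ X b) (r a)).det := by
  -- `T = S + U * W` is a low-rank update, so the determinant lemma gives the factor `det (1 + W *
  -- S⁻¹ * U)`. The columns of `S⁻¹ * U` are the `X a`, and the `1` is cancelled by the rows of `S`
  -- subtracted in `W`.
  set U : Matrix m κ ℂ := Matrix.of fun i a => if i = r a then 1 else 0 with hU
  set W : Matrix κ m ℂ := Matrix.of fun a i => T (r a) i - S (r a) i with hW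
  have hT : T = S + U * W := by
    ext i l
    rw [Matrix.add_apply, Matrix.mul_apply]
    by_cases hi : i ∈ Set.range r
    · obtain ⟨a, rfl⟩ := hi
      simp [hU, hW, hr.eq_iff]
    · have : ∀ a, i ≠ r a := fun a h => hi ⟨a, h.symm⟩
      simp [hU, this, hTS i hi]
  have hunit : IsUnit S.det := isUnit_iff_ne_zero.2 hS
  have hSU : S⁻¹ * U = Matrix.of fun i a => X a i := by
    have h1 : U = S * Matrix.of fun i a => X a i := by
      ext i a
      have := congrFun (hX a) i
      simp only [Matrix.mulVec, dotProduct] at this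
      simp [Matrix.mul_apply, this, hU, Pi.single_apply]
    rw [h1, ← Matrix.mul_assoc, Matrix.nonsing_inv_mul _ hunit, Matrix.one_mul]
  have h2 : (1 : Matrix κ κ ℂ) + W * S⁻¹ * U = Matrix.of fun a b => (T *ᵥ X b) (r a) := by
    ext a b
    have h3 : (S *ᵥ X b) (r a) = (1 : Matrix κ κ ℂ) a b := by
      rw [hX b, Pi.single_apply, Matrix.one_apply]
      simp [hr.eq_iff]
    rw [Matrix.mul_assoc, hSU, Matrix.add_apply, ← h3, Matrix.mul_apply]
    simp [hW, Matrix.mulVec, dotProduct, sub_mul]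
  conv_lhs => rw [hT]
  rw [Matrix.det_add_mul _ _ hunit, h2]

theorem det_sum_unit (M : Matrix (Unit ⊕ Unit) (Unit ⊕ Unit) ℂ) :
    M.det = M (Sum.inl ()) (Sum.inl ()) * M (Sum.inr ()) (Sum.inr ()) -
      M (Sum.inl ()) (Sum.inr ()) * M (Sum.inr ()) (Sum.inl ()) := by
  set e : Fin 2 ≃ Unit ⊕ Unit := finSumFinEquiv.symm.trans
    (Equiv.sumCongr (Equiv.ofUnique (Fin 1) Unit) (Equiv.ofUnique (Fin 1) Unit)) with he
  rw [← Matrix.det_submatrix_equiv_self e, Matrix.det_fin_two]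
  rfl

theorem theMatrix_eq {C : Matrix (Fin 2) (Fin 2) ℂ → Prop} {M : Matrix (Fin 2) (Fin 2) ℂ}
    {g : (Fin 2 → ℂ) → Fin 2 → ℂ} (hC : ∀ M, C M ↔ ∀ f, M *ᵥ f = g f)
    (hM : ∀ f, M *ᵥ f = g f) : theMatrix C = M := by
  have hex : ∃ M, C M := ⟨M, (hC M).2 hM⟩
  rw [theMatrix, dif_pos hex]
  exact Matrix.mulVec_injective (funext fun f =>
    ((hC _).1 hex.choose_spec f).trans (hM f).symm)

namespace Problem

/-! #### Intervals with the Dirichlet condition at the left endpoint -/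

section Dirichlet

variable {Q : Problem Unit} (hQ : Q.IsRegular) (h₁ : Q.α₁ = 1) (h₂ : Q.α₂ = 0)

/-- The boundary condition at the right endpoint, as a function of the value and the derivative at
the left endpoint. -/
noncomputable def rightTrace (Q : Problem Unit) (z : ℂ) (c : ℂ × ℂ) : ℂ :=
  Q.β₁ () () * (edgeSol (Q.a ()) (Q.b ()) (Q.V ()) z c (Q.b ())).1 +
    Q.β₂ () () * (edgeSol (Q.a ()) (Q.b ()) (Q.V ()) z c (Q.b ())).2

theorem edgeSol_apply_mk (a b : ℝ) (q : ℝ → ℝ) (z x y : ℂ) (t : ℝ) :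
    edgeSol a b q z (x, y) t = x • edgeSol a b q z (1, 0) t + y • edgeSol a b q z (0, 1) t := by
  have h : ((x, y) : ℂ × ℂ) = x • (1, 0) + y • (0, 1) := by ext <;> simp
  rw [h, map_add, map_smul, map_smul]
  rfl

theorem rightTrace_mk (Q : Problem Unit) (z x y : ℂ) :
    Q.rightTrace z (x, y) = x * Q.rightTrace z (1, 0) + y * Q.rightTrace z (0, 1) := by
  simp only [rightTrace]
  rw [edgeSol_apply_mk]
  simp only [Prod.fst_add, Prod.snd_add, Prod.smul_fst, Prod.smul_snd, smul_eq_mul]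
  ring

include hQ h₁ h₂

theorem IsRegular.charMap_dirichlet (z : ℂ) (c : Unit ⊕ Unit → ℂ) :
    Q.charMap z c = Sum.elim (fun _ => Q.rightTrace z (c (Sum.inl ()), c (Sum.inr ())))
      (fun _ => c (Sum.inl ())) := by
  ext r
  rcases r with r | r
  · rw [charMap_inl]
    simp [Matrix.mulVec, dotProduct, rightTrace, sol]
  · rw [hQ.charMap_inr]
    simp [h₁, h₂]

/-- The sign enters once for each of the two outer pieces, so it disappears from the final quotient.
-/
theorem IsRegular.charFun_dirichlet (z : ℂ) : Q.charFun z = -Q.rightTrace z (0, 1) := by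
  rw [charFun, det_sum_unit]
  simp only [charMatrix_apply, hQ.charMap_dirichlet h₁ h₂]
  simp

/-- The data at the left endpoint of the solution with the boundary values `f` and `g`. -/
theorem IsRegular.charMap_dirichlet_data {z : ℂ} (hz : Q.charFun z ≠ 0) (f g : ℂ) :
    Q.charMap z (Sum.elim (fun _ => g)
      (fun _ => (f - Q.rightTrace z (1, 0) * g) / Q.rightTrace z (0, 1))) =
      Sum.elim (fun _ => f) (fun _ => g) := by
  have h0 : Q.rightTrace z (0, 1) ≠ 0 := by
    rw [hQ.charFun_dirichlet h₁ h₂, neg_ne_zero] at hz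
    exact hz
  rw [hQ.charMap_dirichlet h₁ h₂]
  congr 1
  funext _
  simp only [Sum.elim_inl, Sum.elim_inr]
  rw [rightTrace_mk]
  field_simp
  ring

end Dirichlet

/-! #### Regularity and self-adjointness of the pieces -/

variable {ι : Type} [Fintype ι] [DecidableEq ι] {P : Problem ι} {j : ι} {s : ℝ}

omit [Fintype ι] in
theorem IsRegular.innerPiece (hP : P.IsRegular) (h₁ : P.a j < s) (h₂ : s ≤ P.b j) :
    (P.innerPiece j s).IsRegular := by
  intro i
  by_cases hi : i = j
  · subst hi
    refine ⟨by simpa [Problem.innerPiece] using h₁, ?_⟩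
    simp only [Problem.innerPiece, Function.update_self]
    refine (hP i).2.mono_set ?_
    rw [uIcc_of_le h₁.le, uIcc_of_le (hP i).1.le]
    exact Icc_subset_Icc_right h₂
  · simpa [Problem.innerPiece, hi] using hP i

omit [Fintype ι] [DecidableEq ι] in
theorem IsRegular.outerPiece (hP : P.IsRegular) (h₁ : P.a j ≤ s) (h₂ : s < P.b j) :
    (P.outerPiece j s).IsRegular := by
  intro i
  refine ⟨h₂, (hP j).2.mono_set ?_⟩
  simp only [Problem.outerPiece]
  rw [uIcc_of_le h₂.le, uIcc_of_le (hP j).1.le]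
  exact Icc_subset_Icc_left h₁

/-- The conditions at the outer vertices are local. -/
def IsLocal (P : Problem ι) : Prop := P.β₁.IsDiag ∧ P.β₂.IsDiag

omit [Fintype ι] in
theorem IsLocal.innerPiece (h : P.IsLocal) (j : ι) (s : ℝ) : (P.innerPiece j s).IsLocal := by
  constructor
  · intro a b hab
    by_cases ha : a = j
    · subst ha
      simp [Problem.innerPiece, Ne.symm hab]
    · simpa [Problem.innerPiece, ha] using h.1 hab
  · intro a b hab
    by_cases ha : a = j
    · subst ha
      simp [Problem.innerPiece]
    · simpa [Problem.innerPiece, ha] using h.2 hab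

omit [DecidableEq ι] in
theorem mulVec_of_isDiag {A : Matrix ι ι ℂ} (hA : A.IsDiag) (x : ι → ℂ) (i : ι) :
    (A *ᵥ x) i = A i i * x i := by
  rw [Matrix.mulVec, dotProduct, Finset.sum_eq_single i]
  · intro b _ hb
    rw [hA (Ne.symm hb), zero_mul]
  · simp

/-- For local conditions isotropy is checked vertex by vertex, so replacing one row by a Dirichlet
condition preserves it. -/
theorem isIsotropic_iff_of_isDiag {A B : Matrix ι ι ℂ} (hA : A.IsDiag) (hB : B.IsDiag) :
    IsIsotropic A B ↔ ∀ i, ∀ x y x' y' : ℂ, A i i * x + B i i * y = 0 →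
      A i i * x' + B i i * y' = 0 → star x * y' = star y * x' := by
  constructor
  · intro h i x y x' y' h1 h2
    have key : ∀ x y : ℂ, A i i * x + B i i * y = 0 →
        A *ᵥ Pi.single i x + B *ᵥ Pi.single i y = 0 := by
      intro x y hxy
      ext l
      rw [Pi.add_apply, mulVec_of_isDiag hA, mulVec_of_isDiag hB]
      by_cases hl : l = i
      · subst hl
        simpa using hxy
      · simp [hl]
    have h3 := h _ _ _ _ (key x y h1) (key x' y' h2)
    rw [dotProduct_single, dotProduct_single] at h3
    simpa using h3
  · intro h x y x' y' h1 h2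
    have key : ∀ {x y : ι → ℂ}, A *ᵥ x + B *ᵥ y = 0 → ∀ i, A i i * x i + B i i * y i = 0 := by
      intro x y hxy i
      have := congrFun hxy i
      rwa [Pi.add_apply, mulVec_of_isDiag hA, mulVec_of_isDiag hB] at this
    exact Finset.sum_congr rfl fun i _ => h i _ _ _ _ (key h1 i) (key h2 i)

theorem IsSelfAdjoint.innerPiece (h : P.IsSelfAdjoint) (hl : P.IsLocal) (j : ι) (s : ℝ) :
    (P.innerPiece j s).IsSelfAdjoint := by
  refine ⟨h.1, ?_⟩
  have hl' := hl.innerPiece j s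
  rw [isIsotropic_iff_of_isDiag hl'.1 hl'.2]
  have h2 := (isIsotropic_iff_of_isDiag hl.1 hl.2).1 h.2
  intro i x y x' y'
  by_cases hi : i = j
  · subst hi
    simp only [Problem.innerPiece, Matrix.updateRow_self, Pi.single_eq_same, Pi.zero_apply,
      one_mul, zero_mul, add_zero]
    rintro rfl rfl
    simp
  · simpa [Problem.innerPiece, hi] using h2 i x y x' y'

theorem IsSelfAdjoint.outerPiece (h : P.IsSelfAdjoint) (hl : P.IsLocal) (j : ι) (s : ℝ) :
    (P.outerPiece j s).IsSelfAdjoint := by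
  have h2 := (isIsotropic_iff_of_isDiag hl.1 hl.2).1 h.2
  have hd : ∀ A : Matrix Unit Unit ℂ, A.IsDiag := fun A a b hab => absurd rfl hab
  constructor
  · rw [isIsotropic_iff_of_isDiag (hd _) (hd _)]
    intro i x y x' y'
    simp only [Problem.outerPiece, Matrix.one_apply_eq, Matrix.zero_apply, one_mul, zero_mul,
      add_zero]
    rintro rfl rfl
    simp
  · rw [isIsotropic_iff_of_isDiag (hd _) (hd _)]
    exact fun _ => h2 j

omit [DecidableEq ι] in
theorem IsLocal.charMap_inl (h : P.IsLocal) (z : ℂ) (c : ι ⊕ ι → ℂ) (i : ι) :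
    P.charMap z c (Sum.inl i) = P.β₁ i i * (P.sol z c i (P.b i)).1 +
      P.β₂ i i * (P.sol z c i (P.b i)).2 := by
  rw [Problem.charMap_inl, Pi.add_apply, mulVec_of_isDiag h.1, mulVec_of_isDiag h.2]

/-! #### The characteristic map of the pieces -/

theorem IsLocal.charMap_innerPiece_inl (h : P.IsLocal) (z : ℂ) (c : ι ⊕ ι → ℂ) (j : ι) (s : ℝ) :
    (P.innerPiece j s).charMap z c (Sum.inl j) = ((P.innerPiece j s).sol z c j s).1 := by
  rw [(h.innerPiece j s).charMap_inl]
  simp [Problem.innerPiece]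

omit [Fintype ι] in
theorem sol_innerPiece_of_ne (P : Problem ι) (z : ℂ) (c : ι ⊕ ι → ℂ) {i j : ι} (hi : i ≠ j)
    (s : ℝ) : (P.innerPiece j s).sol z c i = P.sol z c i := by
  funext x
  simp [sol, Problem.innerPiece, hi]

omit [Fintype ι] in
theorem IsRegular.sol_innerPiece (hP : P.IsRegular) (h₁ : P.a j ≤ s) (h₂ : s ≤ P.b j) (z : ℂ)
    (c : ι ⊕ ι → ℂ) {x : ℝ} (hx : x ∈ Icc (P.a j) s) :
    (P.innerPiece j s).sol z c j x = P.sol z c j x := by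
  rw [sol, sol, edgeSol_restrict h₁ h₂ (hP j).2 z _ hx]
  simp [Problem.innerPiece]

/-- Data sit at the common vertex and the outer conditions are local, so a cut on edge `j` affects a
single row of the characteristic matrix. -/
theorem IsLocal.charMap_innerPiece_of_ne (h : P.IsLocal) (hP : P.IsRegular)
    (h₁ : P.a j < s) (h₂ : s ≤ P.b j) (z : ℂ) (c : ι ⊕ ι → ℂ) {r : ι ⊕ ι} (hr : r ≠ Sum.inl j) :
    (P.innerPiece j s).charMap z c r = P.charMap z c r := by
  rcases r with i | i
  · have hi : i ≠ j := fun h => hr (h ▸ rfl)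
    rw [h.charMap_inl, (h.innerPiece j s).charMap_inl, sol_innerPiece_of_ne P z c hi]
    simp [Problem.innerPiece, hi]
  · rw [hP.charMap_inr, (hP.innerPiece h₁ h₂).charMap_inr]
    rfl

-- The remaining row of the uncut problem factors through the cut point: the outer piece carries the
-- Cauchy data at `s` to the end of the edge.
omit [DecidableEq ι] in
theorem IsLocal.charMap_eq_rightTrace (h : P.IsLocal) (hP : P.IsRegular)
    (h₁ : P.a j ≤ s) (h₂ : s ≤ P.b j) (z : ℂ) (c : ι ⊕ ι → ℂ) :
    P.charMap z c (Sum.inl j) = (P.outerPiece j s).rightTrace z (P.sol z c j s) := by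
  rw [h.charMap_inl, rightTrace]
  have : P.sol z c j (P.b j) = edgeSol s (P.b j) (P.V j) z (P.sol z c j s) (P.b j) :=
    edgeSol_transport h₁ h₂ (hP j).2 z _ (right_mem_Icc.2 h₂)
  rw [this]
  rfl

end Problem

end QuantumStar

namespace QuantumStar

/-! ### The two-sided Dirichlet-to-Neumann map -/

/-- The homogeneous condition at the far end is linear in the value and derivative at the cut;
solving it for minus the derivative gives the quotient. The two pieces are decoupled, hence the
diagonal form. -/
theorem theMatrix_isTwoWireM₁ {Q R : Problem Unit} {z : ℂ} (hQ : Q.IsRegular) (hQ₁ : Q.α₁ = 1)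
    (hQ₂ : Q.α₂ = 0) (hR : R.IsRegular) (hR₁ : R.α₁ = 1) (hR₂ : R.α₂ = 0)
    (hzQ : Q.charFun z ≠ 0) (hzR : R.charFun z ≠ 0) :
    theMatrix (IsTwoWireM₁ Q R z) = !![Q.rightTrace z (1, 0) / Q.rightTrace z (0, 1), 0;
      0, R.rightTrace z (1, 0) / R.rightTrace z (0, 1)] := by
  have hiQ := (Q.charMap_injective_iff z).2 hzQ
  have hiR := (R.charMap_injective_iff z).2 hzR
  refine theMatrix_eq (g := fun f => ![Q.rightTrace z (1, 0) / Q.rightTrace z (0, 1) * f 0,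
    R.rightTrace z (1, 0) / R.rightTrace z (0, 1) * f 1]) (fun M => forall_congr' fun f => ?_)
    (fun f => ?_)
  · have hcQ := hQ.charMap_dirichlet_data hQ₁ hQ₂ hzQ 0 (f 0)
    have hcR := hR.charMap_dirichlet_data hR₁ hR₂ hzR 0 (f 1)
    constructor
    · rintro ⟨u, u', v, v', hu, hv, hM⟩
      have e1 := congrArg Prod.snd (hu.1.eq_sol hQ hiQ hcQ () (left_mem_Icc.2 (hQ ()).1.le))
      have e2 := congrArg Prod.snd (hv.1.eq_sol hR hiR hcR () (left_mem_Icc.2 (hR ()).1.le))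
      rw [hQ.sol_left] at e1
      rw [hR.sol_left] at e2
      simp only [Sum.elim_inr] at e1 e2
      rw [hM, e1, e2]
      congr 1
      · ring
      · congr 1
        ring
    · intro hM
      refine ⟨_, _, _, _, hQ.isUniqueSolution_sol hiQ hcQ, hR.isUniqueSolution_sol hiR hcR, ?_⟩
      rw [hM, hQ.sol_left, hR.sol_left]
      simp only [Sum.elim_inr]
      congr 1
      · ring
      · congr 1
        ring
  · ext a
    fin_cases a <;> simp [Matrix.mulVec, dotProduct]

theorem theMatrix_isTwoWireM₂ {ι : Type} [Fintype ι] [DecidableEq ι] {S : Problem ι} {j k : ι}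
    {z : ℂ} (hS : S.IsRegular) (hz : S.charFun z ≠ 0) {X : Fin 2 → ι ⊕ ι → ℂ}
    (hX₀ : S.charMap z (X 0) = Pi.single (Sum.inl j) 1)
    (hX₁ : S.charMap z (X 1) = Pi.single (Sum.inl k) 1) :
    theMatrix (IsTwoWireM₂ S j k z) =
      Matrix.of fun a b => (S.sol z (X b) (![j, k] a) (S.b (![j, k] a))).2 := by
  have hi := (S.charMap_injective_iff z).2 hz
  refine theMatrix_eq (g := fun f => ![(S.sol z (f 0 • X 0 + f 1 • X 1) j (S.b j)).2,
    (S.sol z (f 0 • X 0 + f 1 • X 1) k (S.b k)).2]) (fun M => forall_congr' fun f => ?_)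
    (fun f => ?_)
  · have hc : S.charMap z (f 0 • X 0 + f 1 • X 1) =
        (Sum.elim (Pi.single j (f 0) + Pi.single k (f 1)) 0 : ι ⊕ ι → ℂ) := by
      rw [map_add, map_smul, map_smul, hX₀, hX₁]
      ext r
      rcases r with r | r <;> simp [Pi.single_apply]
    constructor
    · rintro ⟨u, u', hu, hM⟩
      have e := fun i => congrArg Prod.snd
        (hu.1.eq_sol hS hi hc i (right_mem_Icc.2 (hS i).1.le))
      rw [hM, ← e j, ← e k]
    · intro hM
      exact ⟨_, _, hS.isUniqueSolution_sol hi hc, hM⟩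
  · ext a
    fin_cases a <;>
      simp [Matrix.mulVec, dotProduct, Problem.sol_add, Problem.sol_smul, mul_comm]

theorem theMatrix_isOneWireM₁ {R : Problem Unit} {z : ℂ} (hR : R.IsRegular) (hR₁ : R.α₁ = 1)
    (hR₂ : R.α₂ = 0) (hβ₁ : R.β₁ () () = 1) (hβ₂ : R.β₂ () () = 0) (hz : R.charFun z ≠ 0) :
    theMatrix (IsOneWireM₁ R z) = (R.rightTrace z (0, 1))⁻¹ •
      !![(edgeSol (R.a ()) (R.b ()) (R.V ()) z (0, 1) (R.b ())).2, -1;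
        -1, R.rightTrace z (1, 0)] := by
  have hi := (R.charMap_injective_iff z).2 hz
  have hq : R.rightTrace z (0, 1) ≠ 0 := by
    rw [hR.charFun_dirichlet hR₁ hR₂, neg_ne_zero] at hz
    exact hz
  set p := R.rightTrace z (1, 0) with hp
  set q := R.rightTrace z (0, 1) with hq'
  -- The Wronskian of the fundamental system equals one; it simplifies the upper right entry to `-1
  -- / q`.
  have hw : p * (edgeSol (R.a ()) (R.b ()) (R.V ()) z (0, 1) (R.b ())).2 -
      (edgeSol (R.a ()) (R.b ()) (R.V ()) z (1, 0) (R.b ())).2 * q = 1 := by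
    have hab := (hR ()).1.le
    have h := (isEdgeSol_edgeSol hab (hR ()).2 z (1, 0)).wronskian hab
      (isEdgeSol_edgeSol hab (hR ()).2 z (0, 1)) (right_mem_Icc.2 hab)
    simp only [edgeSol_left hab (hR ()).2] at h
    rw [hp, hq', Problem.rightTrace, Problem.rightTrace, hβ₁, hβ₂]
    linear_combination h
  have hb : ∀ x y : ℂ, (R.sol z (Sum.elim (fun _ => x) (fun _ => y)) () (R.b ())).2 =
      x * (edgeSol (R.a ()) (R.b ()) (R.V ()) z (1, 0) (R.b ())).2 +
        y * (edgeSol (R.a ()) (R.b ()) (R.V ()) z (0, 1) (R.b ())).2 := fun x y => by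
    rw [Problem.sol, Sum.elim_inl, Sum.elim_inr, Problem.edgeSol_apply_mk]
    rfl
  refine theMatrix_eq (g := fun f => ![f 1 * (edgeSol (R.a ()) (R.b ()) (R.V ()) z (1, 0)
    (R.b ())).2 + (f 0 - p * f 1) / q * (edgeSol (R.a ()) (R.b ()) (R.V ()) z (0, 1) (R.b ())).2,
    -((f 0 - p * f 1) / q)]) (fun M => forall_congr' fun f => ?_) (fun f => ?_)
  · have hc := hR.charMap_dirichlet_data hR₁ hR₂ hz (f 0) (f 1)
    constructor
    · rintro ⟨u, u', hu, hM⟩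
      have e1 := congrArg Prod.snd (hu.1.eq_sol hR hi hc () (left_mem_Icc.2 (hR ()).1.le))
      have e2 := congrArg Prod.snd (hu.1.eq_sol hR hi hc () (right_mem_Icc.2 (hR ()).1.le))
      rw [hR.sol_left] at e1
      rw [hb] at e2
      simp only [Sum.elim_inr] at e1
      dsimp only at e2
      rw [hM, e1, e2]
    · intro hM
      refine ⟨_, _, hR.isUniqueSolution_sol hi hc, ?_⟩
      rw [hM, hR.sol_left, hb]
      rfl
  · ext a
    fin_cases a
    · simp [Matrix.mulVec, dotProduct]
      field_simp
      linear_combination f 1 * hw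
    · simp [Matrix.mulVec, dotProduct]
      field_simp
      ring

theorem theMatrix_isOneWireM₂ {ι : Type} [Fintype ι] [DecidableEq ι] {Q : Problem Unit}
    {S : Problem ι} {j : ι} {z : ℂ} (hQ : Q.IsRegular) (hQ₁ : Q.α₁ = 1) (hQ₂ : Q.α₂ = 0)
    (hS : S.IsRegular) (hzQ : Q.charFun z ≠ 0) (hzS : S.charFun z ≠ 0) {X : ι ⊕ ι → ℂ}
    (hX : S.charMap z X = Pi.single (Sum.inl j) 1) :
    theMatrix (IsOneWireM₂ Q S j z) = !![Q.rightTrace z (1, 0) / Q.rightTrace z (0, 1), 0;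
      0, (S.sol z X j (S.b j)).2] := by
  have hiQ := (Q.charMap_injective_iff z).2 hzQ
  have hiS := (S.charMap_injective_iff z).2 hzS
  refine theMatrix_eq (g := fun f => ![Q.rightTrace z (1, 0) / Q.rightTrace z (0, 1) * f 0,
    f 1 * (S.sol z X j (S.b j)).2]) (fun M => forall_congr' fun f => ?_) (fun f => ?_)
  · have hcQ := hQ.charMap_dirichlet_data hQ₁ hQ₂ hzQ 0 (f 0)
    have hcS : S.charMap z (f 1 • X) = (Sum.elim (Pi.single j (f 1)) 0 : ι ⊕ ι → ℂ) := by
      rw [map_smul, hX]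
      ext r
      rcases r with r | r <;> simp [Pi.single_apply]
    constructor
    · rintro ⟨u, u', v, v', hu, hv, hM⟩
      have e1 := congrArg Prod.snd (hu.1.eq_sol hQ hiQ hcQ () (left_mem_Icc.2 (hQ ()).1.le))
      have e2 := congrArg Prod.snd (hv.1.eq_sol hS hiS hcS j (right_mem_Icc.2 (hS j).1.le))
      rw [hQ.sol_left] at e1
      rw [Problem.sol_smul] at e2
      simp only [Sum.elim_inr] at e1
      dsimp only at e2
      rw [hM, e1, e2]
      congr 1
      ring
    · intro hM
      refine ⟨_, _, _, _, hQ.isUniqueSolution_sol hiQ hcQ, hS.isUniqueSolution_sol hiS hcS, ?_⟩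
      rw [hM, hQ.sol_left, Problem.sol_smul]
      simp only [Sum.elim_inr]
      congr 1
      ring
  · ext a
    fin_cases a <;> simp [Matrix.mulVec, dotProduct, mul_comm]

/-! ### The two-sided determinant as a quotient of characteristic functions. -/

section Splitting

variable {ι : Type} [Fintype ι] [DecidableEq ι] {P : Problem ι} {j k : ι} {s₁ s₂ : ℝ}

theorem exists_charMap_eq {S : Problem ι} {z : ℂ} (hz : S.charFun z ≠ 0) (h : ι ⊕ ι → ℂ) :
    ∃ c, S.charMap z c = h :=
  LinearMap.surjective_of_injective ((S.charMap_injective_iff z).2 hz) h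

/-- Two rows differ between the matrices of `P` and of `piece₃`. In the resulting two by two
determinant, each row is `rightTrace z (0, 1)` of the corresponding outer piece times a row of the
two-sided map. -/
theorem twoSidedDet_of_ne (hjk : j ≠ k) (hP : P.IsRegular) (hl : P.IsLocal)
    (h₁ : P.a j < s₁ ∧ s₁ < P.b j)
    (h₂ : P.a k < s₂ ∧ s₂ < (P.innerPiece j s₁).b k) {z : ℂ}
    (hz₁ : (piece₁ P j s₁).charFun z ≠ 0) (hz₂ : (piece₂ P j k s₁ s₂).charFun z ≠ 0)
    (hz₃ : (piece₃ P j k s₁ s₂).charFun z ≠ 0) :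
    twoSidedDet P j k s₁ s₂ z = P.charFun z / ((piece₁ P j s₁).charFun z *
      (piece₂ P j k s₁ s₂).charFun z * (piece₃ P j k s₁ s₂).charFun z) := by
  set P' := P.innerPiece j s₁ with hP'
  set Q := piece₁ P j s₁ with hQdef
  set R := piece₂ P j k s₁ s₂ with hRdef
  set S := piece₃ P j k s₁ s₂ with hSdef
  have hreg' : P'.IsRegular := hP.innerPiece h₁.1 h₁.2.le
  have hQ : Q.IsRegular := hP.outerPiece h₁.1.le h₁.2
  have hR : R.IsRegular := hreg'.outerPiece h₂.1.le h₂.2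
  have hS : S.IsRegular := hreg'.innerPiece h₂.1 h₂.2.le
  have hl' : P'.IsLocal := hl.innerPiece j s₁
  obtain ⟨X₀, hX₀⟩ := exists_charMap_eq hz₃ (Pi.single (Sum.inl j) 1)
  obtain ⟨X₁, hX₁⟩ := exists_charMap_eq hz₃ (Pi.single (Sum.inl k) 1)
  have hSj : S.b j = s₁ := by simp [hSdef, piece₃, Problem.innerPiece, hjk]
  have hSk : S.b k = s₂ := by simp [hSdef, piece₃, Problem.innerPiece]
  have hvalj : ∀ c, (S.sol z c j s₁).1 = S.charMap z c (Sum.inl j) := fun c =>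
    (congrArg Prod.fst (congrFun (P'.sol_innerPiece_of_ne z c hjk s₂) s₁)).trans
      ((hl.charMap_innerPiece_inl z c j s₁).symm.trans
        (hl'.charMap_innerPiece_of_ne hreg' h₂.1 h₂.2.le z c (by simpa using hjk)).symm)
  have hvalk : ∀ c, (S.sol z c k s₂).1 = S.charMap z c (Sum.inl k) := fun c =>
    (hl'.charMap_innerPiece_inl z c k s₂).symm
  have hPj : ∀ c, P.charMap z c (Sum.inl j) = Q.rightTrace z (S.sol z c j s₁) := fun c => by
    rw [hl.charMap_eq_rightTrace hP h₁.1.le h₁.2.le,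
      ← hP.sol_innerPiece h₁.1.le h₁.2.le z c (right_mem_Icc.2 h₁.1.le)]
    exact congrArg _ (congrFun (P'.sol_innerPiece_of_ne z c hjk s₂) s₁).symm
  have hPk : ∀ c, P.charMap z c (Sum.inl k) = R.rightTrace z (S.sol z c k s₂) := fun c => by
    rw [← hl.charMap_innerPiece_of_ne hP h₁.1 h₁.2.le z c (by simpa using hjk.symm),
      hl'.charMap_eq_rightTrace hreg' h₂.1.le h₂.2.le,
      ← hreg'.sol_innerPiece h₂.1.le h₂.2.le z c (right_mem_Icc.2 h₂.1.le)]
    rfl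
  have hM₁ := (show bigM₁ P j k s₁ s₂ z = theMatrix (IsTwoWireM₁ Q R z) from if_neg hjk).trans <|
    theMatrix_isTwoWireM₁ hQ rfl rfl hR rfl rfl hz₁ hz₂
  have hM₂ := (show bigM₂ P j k s₁ s₂ z = theMatrix (IsTwoWireM₂ S j k z) from if_neg hjk).trans <|
    theMatrix_isTwoWireM₂ hS hz₃ (X := ![X₀, X₁]) hX₀ hX₁
  have hdet := det_eq_det_mul_of_rows (T := P.charMatrix z) (S := S.charMatrix z) hz₃
    (r := ![Sum.inl j, Sum.inl k]) (X := ![X₀, X₁])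
    (by
      intro a b
      fin_cases a <;> fin_cases b <;> simp [hjk, hjk.symm])
    (fun i hi => by
      have hij : i ≠ Sum.inl j := fun h => hi ⟨0, h.symm⟩
      have hik : i ≠ Sum.inl k := fun h => hi ⟨1, h.symm⟩
      funext l
      rw [Problem.charMatrix_apply, Problem.charMatrix_apply,
        ← hl.charMap_innerPiece_of_ne hP h₁.1 h₁.2.le z _ hij,
        ← hl'.charMap_innerPiece_of_ne hreg' h₂.1 h₂.2.le z _ hik]
      rfl)
    (fun a => by
      rw [Problem.charMatrix_mulVec]
      fin_cases a
      · exact hX₀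
      · exact hX₁)
  have hq₁ : Q.rightTrace z (0, 1) ≠ 0 := by
    rw [hQ.charFun_dirichlet rfl rfl, neg_ne_zero] at hz₁
    exact hz₁
  have hq₂ : R.rightTrace z (0, 1) ≠ 0 := by
    rw [hR.charFun_dirichlet rfl rfl, neg_ne_zero] at hz₂
    exact hz₂
  have hrt : ∀ (T : Problem Unit) (v : ℂ × ℂ), T.rightTrace z v =
      v.1 * T.rightTrace z (1, 0) + v.2 * T.rightTrace z (0, 1) := fun T v =>
    T.rightTrace_mk z v.1 v.2
  have e00 : (S.sol z X₀ j s₁).1 = 1 := by rw [hvalj, hX₀]; simp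
  have e01 : (S.sol z X₁ j s₁).1 = 0 := by rw [hvalj, hX₁]; simp [hjk]
  have e10 : (S.sol z X₀ k s₂).1 = 0 := by rw [hvalk, hX₀]; simp [hjk.symm]
  have e11 : (S.sol z X₁ k s₂).1 = 1 := by rw [hvalk, hX₁]; simp
  have hP0 : P.charFun z = S.charFun z *
      ((Q.rightTrace z (1, 0) + (S.sol z X₀ j s₁).2 * Q.rightTrace z (0, 1)) *
        (R.rightTrace z (1, 0) + (S.sol z X₁ k s₂).2 * R.rightTrace z (0, 1)) -
      ((S.sol z X₁ j s₁).2 * Q.rightTrace z (0, 1)) *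
        ((S.sol z X₀ k s₂).2 * R.rightTrace z (0, 1))) := by
    rw [Problem.charFun, hdet, Matrix.det_fin_two]
    simp only [Matrix.of_apply, Problem.charMatrix_mulVec, Matrix.cons_val_zero,
      Matrix.cons_val_one, hPj, hPk]
    rw [hrt Q (S.sol z X₀ j s₁), hrt Q (S.sol z X₁ j s₁), hrt R (S.sol z X₀ k s₂),
      hrt R (S.sol z X₁ k s₂), e00, e01, e10, e11, Problem.charFun]
    ring
  rw [twoSidedDet, hM₁, hM₂, hP0, hQ.charFun_dirichlet rfl rfl, hR.charFun_dirichlet rfl rfl,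
    Matrix.det_fin_two]
  simp only [Matrix.add_apply, Matrix.of_apply, Matrix.cons_val', Matrix.cons_val_zero,
    Matrix.cons_val_one, Matrix.cons_val_fin_one, hSj, hSk, zero_add]
  field_simp

/-- Both cuts lie on one edge, so only one row differs. The remaining scalar propagates the data at
`s₂` first through the middle piece and then through the outer one. -/
theorem twoSidedDet_of_eq (hP : P.IsRegular) (hl : P.IsLocal)
    (h₁ : P.a j < s₁ ∧ s₁ < P.b j)
    (h₂ : P.a j < s₂ ∧ s₂ < (P.innerPiece j s₁).b j) {z : ℂ}
    (hz₁ : (piece₁ P j s₁).charFun z ≠ 0) (hz₂ : (piece₂ P j j s₁ s₂).charFun z ≠ 0)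
    (hz₃ : (piece₃ P j j s₁ s₂).charFun z ≠ 0) :
    twoSidedDet P j j s₁ s₂ z = P.charFun z / ((piece₁ P j s₁).charFun z *
      (piece₂ P j j s₁ s₂).charFun z * (piece₃ P j j s₁ s₂).charFun z) := by
  set P' := P.innerPiece j s₁ with hP'
  set Q := piece₁ P j s₁ with hQdef
  set R := piece₂ P j j s₁ s₂ with hRdef
  set S := piece₃ P j j s₁ s₂ with hSdef
  have hreg' : P'.IsRegular := hP.innerPiece h₁.1 h₁.2.le
  have hQ : Q.IsRegular := hP.outerPiece h₁.1.le h₁.2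
  have hR : R.IsRegular := hreg'.outerPiece h₂.1.le h₂.2
  have hS : S.IsRegular := hreg'.innerPiece h₂.1 h₂.2.le
  have hl' : P'.IsLocal := hl.innerPiece j s₁
  obtain ⟨X, hX⟩ := exists_charMap_eq hz₃ (Pi.single (Sum.inl j) 1)
  have hSj : S.b j = s₂ := by simp [hSdef, piece₃, Problem.innerPiece]
  have hb' : P'.b j = s₁ := by simp [hP', Problem.innerPiece]
  have hRβ₁ : R.β₁ () () = 1 := by simp [hRdef, piece₂, Problem.innerPiece, Problem.outerPiece]
  have hRβ₂ : R.β₂ () () = 0 := by simp [hRdef, piece₂, Problem.innerPiece, Problem.outerPiece]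
  have hval : (S.sol z X j s₂).1 = 1 := by
    have h := hl'.charMap_innerPiece_inl z X j s₂
    have h' := congrFun hX (Sum.inl j)
    rw [Pi.single_eq_same] at h'
    exact h.symm.trans h'
  have hPj : P.charMap z X (Sum.inl j) = Q.rightTrace z
      (edgeSol (R.a ()) (R.b ()) (R.V ()) z (S.sol z X j s₂) (R.b ())) := by
    rw [hl.charMap_eq_rightTrace hP h₁.1.le h₁.2.le,
      ← hP.sol_innerPiece h₁.1.le h₁.2.le z X (right_mem_Icc.2 h₁.1.le)]
    have ht := edgeSol_transport h₂.1.le h₂.2.le (hreg' j).2 z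
      (X (Sum.inl j), X (Sum.inr j)) (right_mem_Icc.2 h₂.2.le)
    have hr : S.sol z X j s₂ = P'.sol z X j s₂ :=
      hreg'.sol_innerPiece h₂.1.le h₂.2.le z X (right_mem_Icc.2 h₂.1.le)
    rw [hr]
    refine congrArg _ ?_
    rw [hb'] at ht
    have hRb : R.b () = s₁ := hb'
    rw [hRb]
    refine Eq.trans ?_ (ht.trans ?_)
    · rw [Problem.sol, hb']
      rfl
    · rw [Problem.sol, hb']
      rfl
  have hM₁ := (show bigM₁ P j j s₁ s₂ z = theMatrix (IsOneWireM₁ R z) from if_pos rfl).trans <|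
    theMatrix_isOneWireM₁ hR rfl rfl hRβ₁ hRβ₂ hz₂
  have hM₂ := (show bigM₂ P j j s₁ s₂ z = theMatrix (IsOneWireM₂ Q S j z) from if_pos rfl).trans <|
    theMatrix_isOneWireM₂ hQ rfl rfl hS hz₁ hz₃ hX
  have hdet := det_eq_det_mul_of_rows (T := P.charMatrix z) (S := S.charMatrix z) hz₃
    (r := fun _ : Unit => Sum.inl j) (X := fun _ => X) (fun _ _ _ => rfl)
    (fun i hi => by
      have hij : i ≠ Sum.inl j := fun h => hi ⟨(), h.symm⟩
      funext l
      rw [Problem.charMatrix_apply, Problem.charMatrix_apply,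
        ← hl.charMap_innerPiece_of_ne hP h₁.1 h₁.2.le z _ hij,
        ← hl'.charMap_innerPiece_of_ne hreg' h₂.1 h₂.2.le z _ hij]
      rfl)
    (fun a => by
      rw [Problem.charMatrix_mulVec]
      exact hX)
  have hq₁ : Q.rightTrace z (0, 1) ≠ 0 := by
    rw [hQ.charFun_dirichlet rfl rfl, neg_ne_zero] at hz₁
    exact hz₁
  have hq₂ : R.rightTrace z (0, 1) ≠ 0 := by
    rw [hR.charFun_dirichlet rfl rfl, neg_ne_zero] at hz₂
    exact hz₂
  have hrt : ∀ (T : Problem Unit) (v : ℂ × ℂ), T.rightTrace z v =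
      v.1 * T.rightTrace z (1, 0) + v.2 * T.rightTrace z (0, 1) := fun T v =>
    T.rightTrace_mk z v.1 v.2
  have hwr := (isEdgeSol_edgeSol (hR ()).1.le (hR ()).2 z (1, 0)).wronskian (hR ()).1.le
    (isEdgeSol_edgeSol (hR ()).1.le (hR ()).2 z (0, 1)) (right_mem_Icc.2 (hR ()).1.le)
  simp only [edgeSol_left (hR ()).1.le (hR ()).2] at hwr
  have hR10 : R.rightTrace z (1, 0) =
      (edgeSol (R.a ()) (R.b ()) (R.V ()) z (1, 0) (R.b ())).1 := by
    rw [Problem.rightTrace, hRβ₁, hRβ₂]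
    ring
  have hR01 : R.rightTrace z (0, 1) =
      (edgeSol (R.a ()) (R.b ()) (R.V ()) z (0, 1) (R.b ())).1 := by
    rw [Problem.rightTrace, hRβ₁, hRβ₂]
    ring
  rw [← hR10, ← hR01] at hwr
  set m := (S.sol z X j s₂).2 with hm
  set C' := (edgeSol (R.a ()) (R.b ()) (R.V ()) z (1, 0) (R.b ())).2 with hC'
  set D' := (edgeSol (R.a ()) (R.b ()) (R.V ()) z (0, 1) (R.b ())).2 with hD'
  have hP0 : P.charFun z = S.charFun z *
      ((R.rightTrace z (1, 0) + m * R.rightTrace z (0, 1)) * Q.rightTrace z (1, 0) +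
        (C' + m * D') * Q.rightTrace z (0, 1)) := by
    have hX' : S.sol z X j s₂ = (1, m) := Prod.ext hval rfl
    rw [Problem.charFun, hdet, Matrix.det_unique (n := Unit)]
    simp only [Matrix.of_apply, Problem.charMatrix_mulVec, hPj]
    rw [hX', Problem.edgeSol_apply_mk, hrt Q]
    simp only [Prod.fst_add, Prod.snd_add, Prod.smul_fst, Prod.smul_snd, smul_eq_mul, one_mul]
    rw [hR10, hR01]
    rfl
  rw [twoSidedDet, hM₁, hM₂, hP0, hQ.charFun_dirichlet rfl rfl, hR.charFun_dirichlet rfl rfl,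
    Matrix.det_fin_two]
  simp only [Matrix.add_apply, Matrix.smul_apply, Matrix.of_apply, Matrix.cons_val',
    Matrix.cons_val_zero, Matrix.cons_val_one, Matrix.cons_val_fin_one, hSj, add_zero,
    smul_eq_mul]
  field_simp
  -- The off-diagonal product contributes `1 / q ^ 2`, with `q` the entry `R.rightTrace z (0, 1)`;
  -- the unit Wronskian of the middle piece matches it with the scalar entry.
  linear_combination (Q.rightTrace z (0, 1)) * hwr

end Splitting

end QuantumStar

/-! ### Counting eigenvalues, zeros and poles. -/

namespace QuantumStar

open Filter Topology

namespace Problem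

variable {ι : Type} [Fintype ι] [DecidableEq ι] {P : Problem ι}

/-- The function is entire and nonzero at `I`, so the identity theorem isolates its zeros. -/
theorem IsRegular.eventually_charFun_ne_zero (hP : P.IsRegular) (hS : P.IsSelfAdjoint) (z : ℂ) :
    ∀ᶠ w in 𝓝[≠] z, P.charFun w ≠ 0 := by
  have hm : ∀ w, MeromorphicAt P.charFun w := fun w =>
    (hP.differentiable_charFun.analyticAt w).meromorphicAt
  have hI : P.charFun Complex.I ≠ 0 := (P.charMap_injective_iff _).1
    (hP.charMap_injective_of_im_ne_zero hS (by simp))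
  rw [← meromorphicOrderAt_ne_top_iff_eventually_ne_zero (hm z)]
  refine MeromorphicOn.meromorphicOrderAt_ne_top_of_isPreconnected (U := univ) (x := Complex.I)
    (fun w _ => hm w) isPreconnected_univ (mem_univ _) (mem_univ _) ?_
  rw [meromorphicOrderAt_ne_top_iff_eventually_ne_zero (hm _)]
  exact eventually_nhdsWithin_of_eventually_nhds
    (hP.differentiable_charFun.continuous.continuousAt.eventually_ne hI)

/-- Semiboundedness confines these zeros to a compact interval, where infinitely many would
accumulate. -/
theorem IsRegular.finite_setOf_charFun_eq_zero (hP : P.IsRegular) (hS : P.IsSelfAdjoint)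
    (lam : ℝ) : {μ : ℝ | μ ≤ lam ∧ P.charFun μ = 0}.Finite := by
  obtain ⟨C, hC⟩ := hP.exists_lower_bound hS
  by_contra h
  have hsub : {μ : ℝ | μ ≤ lam ∧ P.charFun μ = 0} ⊆ Icc C lam := fun μ hμ =>
    ⟨not_lt.1 fun hlt => (P.charMap_injective_iff _).1 (hC μ hlt) hμ.2, hμ.1⟩
  obtain ⟨x, -, hx⟩ := Set.Infinite.exists_accPt_of_subset_isCompact h isCompact_Icc hsub
  rw [accPt_iff_frequently_nhdsNE] at hx
  have ht : Tendsto (fun μ : ℝ => (μ : ℂ)) (𝓝[≠] x) (𝓝[≠] (x : ℂ)) :=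
    Complex.continuous_ofReal.continuousAt.continuousWithinAt.tendsto_nhdsWithin
      fun μ hμ => by simpa using hμ
  exact hx ((ht.eventually (hP.eventually_charFun_ne_zero hS x)).mono fun μ hμ hμ' => hμ hμ'.2)

theorem IsRegular.finrank_eigenspace_ne_zero_iff (hP : P.IsRegular) (z : ℂ) :
    Module.finrank ℂ (eigenspace P.operator z) ≠ 0 ↔ P.charFun z = 0 := by
  rw [(P.eigenspaceEquiv hP z).finrank_eq, ← not_iff_not, not_not, ← ne_eq (P.charFun z),
    ← P.charMap_injective_iff, ← LinearMap.ker_eq_bot, Submodule.finrank_eq_zero]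

theorem IsRegular.hasFiniteCount (hP : P.IsRegular) (hS : P.IsSelfAdjoint) (lam : ℝ) :
    HasFiniteCount P.operator lam := by
  have hfin : ∀ z, FiniteDimensional ℂ (eigenspace P.operator z) := fun z =>
    Module.Finite.equiv (P.eigenspaceEquiv hP z).symm
  refine ⟨(hP.finite_setOf_charFun_eq_zero hS lam).subset fun μ hμ => ⟨hμ.1, ?_⟩,
    fun μ _ => hfin μ⟩
  have := hfin μ
  rw [← hP.finrank_eigenspace_ne_zero_iff, ne_eq, Submodule.finrank_eq_zero]
  exact hμ.2

/-- `F` may contain points that are not eigenvalues, which lets all the counts be written over one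
common finite set. -/
theorem IsRegular.eigenvalueCount_eq_sum (hP : P.IsRegular) {lam : ℝ} {F : Finset ℝ}
    (hF : ∀ μ ∈ F, μ ≤ lam) (hF' : ∀ μ : ℝ, μ ≤ lam → P.charFun μ = 0 → μ ∈ F) :
    eigenvalueCount P.operator lam =
      ∑ μ ∈ F, Module.finrank ℂ (eigenspace P.operator (μ : ℂ)) := by
  refine finsum_mem_eq_sum_of_inter_support_eq _ (Set.ext fun μ => and_congr_left fun h => ?_)
  exact ⟨fun hμ => hF' μ hμ ((hP.finrank_eigenspace_ne_zero_iff _).1 h), hF μ⟩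

end Problem

theorem zeroCount_sub_poleCount_eq_sum (D : ℂ → ℂ) {lam : ℝ} {F : Finset ℝ}
    (hF : ∀ μ ∈ F, μ ≤ lam)
    (hF' : ∀ μ : ℝ, μ ≤ lam → meromorphicOrderAt D (μ : ℂ) ≠ 0 → μ ∈ F) :
    (zeroCount D lam : ℤ) - poleCount D lam =
      ∑ μ ∈ F, (meromorphicOrderAt D ((μ : ℝ) : ℂ)).untop₀ := by
  have hz : zeroCount D lam = ∑ μ ∈ F, (meromorphicOrderAt D ((μ : ℝ) : ℂ)).untop₀.toNat := by
    refine finsum_mem_eq_sum_of_inter_support_eq _ (Set.ext fun μ => and_congr_left fun h => ?_)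
    exact ⟨fun hμ => hF' μ hμ fun h0 => h (by simp [h0]), hF μ⟩
  have hp : poleCount D lam = ∑ μ ∈ F, (-(meromorphicOrderAt D ((μ : ℝ) : ℂ)).untop₀).toNat := by
    refine finsum_mem_eq_sum_of_inter_support_eq _ (Set.ext fun μ => and_congr_left fun h => ?_)
    exact ⟨fun hμ => hF' μ hμ fun h0 => h (by simp [h0]), hF μ⟩
  rw [hz, hp, Nat.cast_sum, Nat.cast_sum, ← Finset.sum_sub_distrib]
  exact Finset.sum_congr rfl fun μ _ => Int.toNat_sub_toNat_neg _

section Counting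

variable {ι κ₁ κ₂ κ₃ : Type} [Fintype ι] [DecidableEq ι] [Fintype κ₁] [DecidableEq κ₁]
  [Fintype κ₂] [DecidableEq κ₂] [Fintype κ₃] [DecidableEq κ₃]
  {P : Problem ι} {Q₁ : Problem κ₁} {Q₂ : Problem κ₂} {Q₃ : Problem κ₃} {D : ℂ → ℂ}

/-- If `D` is the characteristic function of `P` divided by those of three other problems, then
its zeros and poles count the difference of the numbers of eigenvalues. -/
theorem counting_of_eq_div (hP : P.IsRegular) (hP' : P.IsSelfAdjoint)
    (h₁ : Q₁.IsRegular) (h₁' : Q₁.IsSelfAdjoint) (h₂ : Q₂.IsRegular) (h₂' : Q₂.IsSelfAdjoint)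
    (h₃ : Q₃.IsRegular) (h₃' : Q₃.IsSelfAdjoint)
    (hD : ∀ z, Q₁.charFun z ≠ 0 → Q₂.charFun z ≠ 0 → Q₃.charFun z ≠ 0 →
      D z = P.charFun z / (Q₁.charFun z * Q₂.charFun z * Q₃.charFun z)) (lam : ℝ) :
    Meromorphic D ∧ (∀ z, meromorphicOrderAt D z ≠ ⊤) ∧
    {μ : ℝ | μ ≤ lam ∧ meromorphicOrderAt D (μ : ℂ) ≠ 0}.Finite ∧
    (eigenvalueCount P.operator lam : ℤ) =
      eigenvalueCount Q₁.operator lam + eigenvalueCount Q₂.operator lam +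
      eigenvalueCount Q₃.operator lam + ((zeroCount D lam : ℤ) - poleCount D lam) := by
  have e₁ := h₁.eventually_charFun_ne_zero h₁'
  have e₂ := h₂.eventually_charFun_ne_zero h₂'
  have e₃ := h₃.eventually_charFun_ne_zero h₃'
  -- At zeros of the denominators the value of `D` is not controlled, but these are isolated and the
  -- meromorphic order ignores the value at the point itself.
  have hcongr : ∀ z, P.charFun / (Q₁.charFun * Q₂.charFun * Q₃.charFun) =ᶠ[𝓝[≠] z] D := fun z => by
    filter_upwards [e₁ z, e₂ z, e₃ z] with w w₁ w₂ w₃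
    exact (hD w w₁ w₂ w₃).symm
  have m : ∀ z, MeromorphicAt P.charFun z := fun z =>
    (hP.differentiable_charFun.analyticAt z).meromorphicAt
  have m₁ : ∀ z, MeromorphicAt Q₁.charFun z := fun z =>
    (h₁.differentiable_charFun.analyticAt z).meromorphicAt
  have m₂ : ∀ z, MeromorphicAt Q₂.charFun z := fun z =>
    (h₂.differentiable_charFun.analyticAt z).meromorphicAt
  have m₃ : ∀ z, MeromorphicAt Q₃.charFun z := fun z =>
    (h₃.differentiable_charFun.analyticAt z).meromorphicAt
  have hmero : Meromorphic D := fun z =>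
    ((m z).div (((m₁ z).mul (m₂ z)).mul (m₃ z))).congr (hcongr z)
  have htop : ∀ z, meromorphicOrderAt D z ≠ ⊤ := fun z => by
    rw [meromorphicOrderAt_ne_top_iff_eventually_ne_zero (hmero z)]
    filter_upwards [hP.eventually_charFun_ne_zero hP' z, e₁ z, e₂ z, e₃ z] with w w₀ w₁ w₂ w₃
    rw [hD w w₁ w₂ w₃]
    exact div_ne_zero w₀ (mul_ne_zero (mul_ne_zero w₁ w₂) w₃)
  have hord : ∀ μ : ℝ, meromorphicOrderAt D (μ : ℂ) =
      (((Module.finrank ℂ (eigenspace P.operator (μ : ℂ)) : ℤ) -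
        (Module.finrank ℂ (eigenspace Q₁.operator (μ : ℂ)) +
          Module.finrank ℂ (eigenspace Q₂.operator (μ : ℂ)) +
          Module.finrank ℂ (eigenspace Q₃.operator (μ : ℂ))) : ℤ) : WithTop ℤ) := fun μ => by
    rw [← meromorphicOrderAt_congr (hcongr μ),
      meromorphicOrderAt_div (m _) (((m₁ _).mul (m₂ _)).mul (m₃ _)),
      meromorphicOrderAt_mul ((m₁ _).mul (m₂ _)) (m₃ _), meromorphicOrderAt_mul (m₁ _) (m₂ _),
      hP.meromorphicOrderAt_charFun hP', h₁.meromorphicOrderAt_charFun h₁',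
      h₂.meromorphicOrderAt_charFun h₂', h₃.meromorphicOrderAt_charFun h₃']
    rfl
  -- The common index set: all zeros up to `lam` of the four characteristic functions, including
  -- those that cancel in the quotient.
  have hfin := (((hP.finite_setOf_charFun_eq_zero hP' lam).union
    (h₁.finite_setOf_charFun_eq_zero h₁' lam)).union
    (h₂.finite_setOf_charFun_eq_zero h₂' lam)).union (h₃.finite_setOf_charFun_eq_zero h₃' lam)
  have hmem : ∀ μ, μ ∈ hfin.toFinset ↔ μ ≤ lam ∧ (P.charFun μ = 0 ∨ Q₁.charFun μ = 0 ∨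
      Q₂.charFun μ = 0 ∨ Q₃.charFun μ = 0) := fun μ => by
    simp only [Finite.mem_toFinset, mem_union, mem_ofPred_eq]
    tauto
  have hle : ∀ μ ∈ hfin.toFinset, μ ≤ lam := fun μ hμ => ((hmem μ).1 hμ).1
  have hDmem : ∀ μ : ℝ, μ ≤ lam → meromorphicOrderAt D (μ : ℂ) ≠ 0 → μ ∈ hfin.toFinset := by
    intro μ hμ h0
    by_contra hcon
    rw [hmem, not_and, not_or, not_or, not_or] at hcon
    obtain ⟨c₀, c₁, c₂, c₃⟩ := hcon hμ
    rw [← hP.finrank_eigenspace_ne_zero_iff, not_not] at c₀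
    rw [← h₁.finrank_eigenspace_ne_zero_iff, not_not] at c₁
    rw [← h₂.finrank_eigenspace_ne_zero_iff, not_not] at c₂
    rw [← h₃.finrank_eigenspace_ne_zero_iff, not_not] at c₃
    refine h0 ?_
    rw [hord, c₀, c₁, c₂, c₃]
    rfl
  refine ⟨hmero, htop, hfin.subset fun μ hμ => hfin.mem_toFinset.1 (hDmem μ hμ.1 hμ.2), ?_⟩
  rw [zeroCount_sub_poleCount_eq_sum D hle hDmem,
    hP.eigenvalueCount_eq_sum hle fun μ h h' => (hmem μ).2 ⟨h, .inl h'⟩,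
    h₁.eigenvalueCount_eq_sum hle fun μ h h' => (hmem μ).2 ⟨h, .inr (.inl h')⟩,
    h₂.eigenvalueCount_eq_sum hle fun μ h h' => (hmem μ).2 ⟨h, .inr (.inr (.inl h'))⟩,
    h₃.eigenvalueCount_eq_sum hle fun μ h h' => (hmem μ).2 ⟨h, .inr (.inr (.inr h'))⟩]
  simp only [hord, WithTop.untop₀_coe, Nat.cast_sum, ← Finset.sum_add_distrib]
  exact Finset.sum_congr rfl fun μ _ => by ring

end Counting

end QuantumStar

theorem mainTheorem4 (n : ℕ) (ℓ : Fin n → ℝ) (hℓ : ∀ i, 0 < ℓ i)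
    (V : Fin n → ℝ → ℝ) (hV : ∀ i, IntervalIntegrable (V i) volume 0 (ℓ i))
    (α₁ α₂ β₁ β₂ : Matrix (Fin n) (Fin n) ℂ)
    (hα : (Matrix.fromCols α₁ α₂).rank = n) (hβ : (Matrix.fromCols β₁ β₂).rank = n)
    (hα' : α₁ * α₂ᴴ = α₂ * α₁ᴴ) (hβ' : β₁ * β₂ᴴ = β₂ * β₁ᴴ)
    (hβ₁ : β₁.IsDiag) (hβ₂ : β₂.IsDiag)
    (j k : Fin n) (s₁ s₂ : ℝ) (hs₁ : 0 < s₁ ∧ s₁ < ℓ j) (hs₂ : 0 < s₂ ∧ s₂ < ℓ k)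
    (hjk : j = k → s₂ < s₁)
    (P : QuantumStar.Problem (Fin n))
    (hP : P = { a := fun _ => 0, b := ℓ, V := V, α₁ := α₁, α₂ := α₂, β₁ := β₁, β₂ := β₂ })
    (lam : ℝ) :
    -- the counting functions are finite
    QuantumStar.HasFiniteCount P.operator lam ∧
    QuantumStar.HasFiniteCount (QuantumStar.piece₁ P j s₁).operator lam ∧
    QuantumStar.HasFiniteCount (QuantumStar.piece₂ P j k s₁ s₂).operator lam ∧
    QuantumStar.HasFiniteCount (QuantumStar.piece₃ P j k s₁ s₂).operator lam ∧
    -- the determinant is meromorphic, nowhere locally zero, with finitely many zeros and poles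
    Meromorphic (QuantumStar.twoSidedDet P j k s₁ s₂) ∧
    (∀ z, meromorphicOrderAt (QuantumStar.twoSidedDet P j k s₁ s₂) z ≠ ⊤) ∧
    {μ : ℝ | μ ≤ lam ∧
      meromorphicOrderAt (QuantumStar.twoSidedDet P j k s₁ s₂) (μ : ℂ) ≠ 0}.Finite ∧
    -- the counting formula
    (QuantumStar.eigenvalueCount P.operator lam : ℤ) =
      QuantumStar.eigenvalueCount (QuantumStar.piece₁ P j s₁).operator lam +
      QuantumStar.eigenvalueCount (QuantumStar.piece₂ P j k s₁ s₂).operator lam +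
      QuantumStar.eigenvalueCount (QuantumStar.piece₃ P j k s₁ s₂).operator lam +
      ((QuantumStar.zeroCount (QuantumStar.twoSidedDet P j k s₁ s₂) lam : ℤ) -
        QuantumStar.poleCount (QuantumStar.twoSidedDet P j k s₁ s₂) lam) := by
  subst hP
  set P : QuantumStar.Problem (Fin n) :=
    { a := fun _ => 0, b := ℓ, V := V, α₁ := α₁, α₂ := α₂, β₁ := β₁, β₂ := β₂ } with hPdef
  have hreg : P.IsRegular := fun i => ⟨hℓ i, hV i⟩
  have hsa : P.IsSelfAdjoint :=
    ⟨QuantumStar.isIsotropic_of_rank (by rw [Fintype.card_fin]; exact hα) hα',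
      QuantumStar.isIsotropic_of_rank (by rw [Fintype.card_fin]; exact hβ) hβ'⟩
  have hloc : P.IsLocal := ⟨hβ₁, hβ₂⟩
  -- The second cut must be interior to edge `k` as it stands after the first cut, where it ends at
  -- `s₁` if `k = j`.
  have hs₂' : s₂ < (P.innerPiece j s₁).b k := by
    change s₂ < Function.update ℓ j s₁ k
    rcases eq_or_ne k j with rfl | h
    · rw [Function.update_self]
      exact hjk rfl
    · rw [Function.update_of_ne h]
      exact hs₂.2
  have hreg' := hreg.innerPiece (j := j) hs₁.1 hs₁.2.le
  have hsa' := hsa.innerPiece hloc j s₁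
  have hloc' := hloc.innerPiece j s₁
  have r₁ : (QuantumStar.piece₁ P j s₁).IsRegular := hreg.outerPiece hs₁.1.le hs₁.2
  have r₂ : (QuantumStar.piece₂ P j k s₁ s₂).IsRegular := hreg'.outerPiece hs₂.1.le hs₂'
  have r₃ : (QuantumStar.piece₃ P j k s₁ s₂).IsRegular := hreg'.innerPiece hs₂.1 hs₂'.le
  have t₁ : (QuantumStar.piece₁ P j s₁).IsSelfAdjoint := hsa.outerPiece hloc j s₁
  have t₂ : (QuantumStar.piece₂ P j k s₁ s₂).IsSelfAdjoint := hsa'.outerPiece hloc' k s₂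
  have t₃ : (QuantumStar.piece₃ P j k s₁ s₂).IsSelfAdjoint := hsa'.innerPiece hloc' k s₂
  refine ⟨hreg.hasFiniteCount hsa lam, r₁.hasFiniteCount t₁ lam, r₂.hasFiniteCount t₂ lam,
    r₃.hasFiniteCount t₃ lam,
    QuantumStar.counting_of_eq_div hreg hsa r₁ t₁ r₂ t₂ r₃ t₃ (fun z z₁ z₂ z₃ => ?_) lam⟩
  by_cases h : j = k
  · subst h
    exact QuantumStar.twoSidedDet_of_eq hreg hloc hs₁ ⟨hs₂.1, hs₂'⟩ z₁ z₂ z₃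
  · exact QuantumStar.twoSidedDet_of_ne h hreg hloc hs₁ ⟨hs₂.1, hs₂'⟩ z₁ z₂ z₃
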